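/- All trees are finite. The eccentricity of a vertex $u$ of a connected graph is its distance to a vertex farthest from it, and the eccentric sequence of the graph is the nondecreasing sequence of the eccentricities of its vertices. Write $(b_1^{(m_1)},\dots,b_l^{(m_l)})$ for the sequence with $l$ distinct entries $b_1<\dots<b_l$, where $b_j$ occurs $m_j\ge 1$ times. For $q\ge 1$ and $r=\lceil q/2\rceil$, let $\mathbb{T}(t_1,\dots,t_r)$ be the caterpillar obtained from the path $v_0,v_1,\dots,v_{q+1}$ by attaching $t_j$ pendant vertices at $v_j$ for all $1\le j\le r$ (the value of $q$ being understood). For a connected graph $G$, a vertex $u$ and edges $e=vw$, $f$ of $G$, put $d(u,e)=\min\{d(u,v),d(u,w)\}$ and $d(e,f)=\min\{d(v,f),d(w,f)\}$, and let $d'(e,f)$ be the distance between $e$ and $f$ in the line graph of $G$. Define $$W_e(G)=\sum_{\{e,f\}\subseteq E(G)} d(e,f),\qquad W'_e(G)=\sum_{\{e,f\}\subseteq E(G)} d'(e,f),\qquad W_{ve}(G)=\frac12\sum_{v\in V(G),\,e\in E(G)} d(v,e),$$ $$W_+(G)=\sum_{\{u,v\}\subseteq V(G)} d(u,v)\,(\deg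 u+\deg v),\qquad W_-(G)=\sum_{\{u,v\}\subseteq V(G)} d(u,v)\,\deg u\,\deg v$$ (the edge Wiener indices $W_e$, $W'_e$, the vertex-edge Wiener index, the Schultz index or degree distance, and the Gutman index). **Corollary.** Let $S=(b_1^{(m_1)},\dots,b_l^{(m_l)})$ be the eccentric sequence of some tree, with $m_1+\dots+m_l>2$. Then $b_l\ge 2$, $l-1=\lfloor b_l/2\rfloor$ and $m_j\ge 2$ for $2\le j\le l$, so that with $q=b_l-1$ the tree $\mathbb{T}_S:=\mathbb{T}(m_l-2,m_{l-1}-2,\dots,m_2-2)$ is well defined; its eccentric sequence is $S$; and for each index $\mathcal{I}\in\{W'_e,W_e,W_{ve},W_+,W_-\}$, every tree $T$ with eccentric sequence $S$ satisfies $\mathcal{I}(T)\ge\mathcal{I}(\mathbb{T}_S)$, with equality if and only if $T$ is isomorphic to $\mathbb{T}_S$. -/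

import Mathlib

namespace EccTree

/-- The sum of `f x y` over all unordered pairs `{x, y}` of distinct elements of `α`. -/
def pairSum {α : Type*} [Fintype α] [DecidableEq α] (f : α → α → ℕ)
    (hf : ∀ x y, f x y = f y x) : ℕ :=
  ∑ p : Sym2 α with ¬ p.IsDiag, Sym2.lift ⟨f, hf⟩ p

/-- Distance between a vertex `u` and an edge `vw`: `min (d u v) (d u w)`. -/
noncomputable def vertexEdgeDist {V : Type*} (G : SimpleGraph V) (u : V) (e : Sym2 V) : ℕ :=
  Sym2.lift ⟨fun v w => min (G.dist u v) (G.dist u w), fun _ _ => min_comm _ _⟩ e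

/-- Distance between an edge `vw` and an edge `f`: `min (d v f) (d w f)`. -/
noncomputable def edgeDist {V : Type*} (G : SimpleGraph V) (e f : Sym2 V) : ℕ :=
  Sym2.lift ⟨fun v w => min (vertexEdgeDist G v f) (vertexEdgeDist G w f),
    fun _ _ => min_comm _ _⟩ e

theorem edgeDist_comm {V : Type*} (G : SimpleGraph V) (e f : Sym2 V) :
    edgeDist G e f = edgeDist G f e := by
  induction e with
  | _ a b =>
    induction f with
    | _ c d =>
      simp only [edgeDist, vertexEdgeDist, Sym2.lift_mk]
      rw [G.dist_comm (u := c) (v := a), G.dist_comm (u := c) (v := b),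
        G.dist_comm (u := d) (v := a), G.dist_comm (u := d) (v := b)]
      omega

section Indices

variable {V : Type*} [Fintype V]

open Classical in
/-- The edge Wiener index `W_e`. -/
noncomputable def edgeWiener (G : SimpleGraph V) : ℕ :=
  pairSum (α := G.edgeSet) (fun e f => edgeDist G e f) fun e f => edgeDist_comm G e f

open Classical in
/-- The edge Wiener index `W'_e`, with distances between edges taken in the line graph. -/
noncomputable def edgeWiener' (G : SimpleGraph V) : ℕ :=
  pairSum (α := G.edgeSet) (fun e f => G.lineGraph.dist e f) fun _ _ => G.lineGraph.dist_comm

open Classical in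
/-- The vertex-edge Wiener index `W_ve`. -/
noncomputable def vertexEdgeWiener (G : SimpleGraph V) : ℚ :=
  (1 / 2 : ℚ) * ∑ v : V, ∑ e ∈ G.edgeFinset, (vertexEdgeDist G v e : ℚ)

open Classical in
/-- The Schultz index (degree distance) `W_+`. -/
noncomputable def schultz (G : SimpleGraph V) : ℕ :=
  pairSum (fun u v => G.dist u v * (G.degree u + G.degree v))
    fun u v => by rw [G.dist_comm, Nat.add_comm]

open Classical in
/-- The Gutman index `W_-`. -/
noncomputable def gutman (G : SimpleGraph V) : ℕ :=
  pairSum (fun u v => G.dist u v * (G.degree u * G.degree v))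
    fun u v => by rw [G.dist_comm, Nat.mul_comm (G.degree u)]

end Indices

/-- Names of the five indices. -/
inductive WienerVariant
  | edge'
  | edge
  | vertexEdge
  | schultz
  | gutman

/-- The value of an index on a finite graph. -/
noncomputable def WienerVariant.index (I : WienerVariant) {V : Type*} [Fintype V]
    (G : SimpleGraph V) : ℚ :=
  match I with
  | .edge' => (EccTree.edgeWiener' G : ℚ)
  | .edge => (EccTree.edgeWiener G : ℚ)
  | .vertexEdge => EccTree.vertexEdgeWiener G
  | .schultz => (EccTree.schultz G : ℚ)
  | .gutman => (EccTree.gutman G : ℚ)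

/-- The nondecreasing sequence of the eccentricities of the vertices of `G`
(each eccentricity is finite when `G` is finite and connected). -/
noncomputable def eccSeq {V : Type*} [Fintype V] (G : SimpleGraph V) : List ℕ :=
  ((Finset.univ : Finset V).val.map fun v => (G.eccent v).toNat).sort (· ≤ ·)

/-- A sequence is tree eccentric if it is the eccentric sequence of some finite tree. -/
def IsTreeEccentric (S : List ℕ) : Prop :=
  ∃ (V : Type) (_ : Fintype V) (T : SimpleGraph V), T.IsTree ∧ eccSeq T = S

/-- The sequence `(b₁^(m₁), …, b_l^(m_l))`: `b₁` repeated `m₁` times, then `b₂` repeated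
`m₂` times, and so on. Only the values of `b` and `m` at `1, …, l` matter. -/
def powerSeq (l : ℕ) (b m : ℕ → ℕ) : List ℕ :=
  (List.range' 1 l).flatMap fun j => List.replicate (m j) (b j)

/-- Vertices of `𝕋(t₁, …, t_r)`, `r = ⌈q / 2⌉`: the path vertices `v₀, …, v_{q+1}`, and for each
`1 ≤ j ≤ r` (here `j` is the element `j - 1` of `Fin r`) a set of `t_j` pendant vertices. -/
abbrev CatVertex (q : ℕ) (t : ℕ → ℕ) : Type :=
  Fin (q + 2) ⊕ (Σ j : Fin ((q + 1) / 2), Fin (t (j.val + 1)))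

/-- The caterpillar `𝕋(t₁, …, t_r)`, `r = ⌈q / 2⌉`: the path `v₀, …, v_{q+1}` with `t_j` pendant
vertices attached at `v_j` for `1 ≤ j ≤ r`. -/
def catTree (q : ℕ) (t : ℕ → ℕ) : SimpleGraph (CatVertex q t) :=
  SimpleGraph.fromRel fun x y =>
    match x, y with
    | .inl i, .inl k => k.val = i.val + 1
    | .inl i, .inr p => i.val = p.1.val + 1
    | .inr _, _ => False

end EccTree

/-! On trees of order n each of the five indices is a positive multiple of the sum of all distances
plus a constant depending only on n (`WienerVariant.index_eq`). The reasons are that every edge can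
be charged to its endpoint farther from a fixed vertex, and that distinct edges are one unit farther
apart in the line graph. The eccentric sequence fixes n, so only `totalDist` has to be minimised.

Fix a diametral path, of length D. Each vertex hangs off the path at a position `pos` and height
`ht`, and has eccentricity ht + max (pos, D - pos). Since D is the largest entry of S, and the
eccentricities along the path depend only on D, the multiset of eccentricities off the path is also
determined by S. Hence there is a bijection φ from T to the caterpillar that respects path positions
and preserves eccentricities off the path (`exists_equiv`). It flattens a vertex of height h to a
pendant vertex, pushed h - 1 steps towards an end of the path.

Under φ, distances between path vertices are unchanged. The distance sum from an off-path x to the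
path drops by at least 4 (ht x - 1) (`sum_path_add_le`). The distance of two off-path vertices can
grow only if one lies below the other, and then by at most 2 (`dist_image_le`); at most ht y - 1
vertices lie below y (`card_below_le`). Over ordered pairs, with s the sum of ht x - 1 off the path,
the gain is at least 8s and the loss at most 4s, so the caterpillar wins by at least 4s
(`totalDist_add_le`).

In case of equality all off-path heights are 1, and pendant vertices cannot hang strictly on both
sides of the centre, because such a pair would get strictly closer. Up to reversing the path,
eccentricities then determine positions, and a key-preserving bijection is an isometry. -/

namespace EccTree

open SimpleGraph

/-! ### Metric properties of trees. -/

section TreeMetric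

variable {V : Type*} {T : SimpleGraph V}

theorem exists_adj_closer (hT : T.Connected) {u v : V} (h : v ≠ u) :
    ∃ w, T.Adj v w ∧ T.dist u v = T.dist u w + 1 := by
  obtain ⟨p, hp⟩ := hT.exists_walk_length_eq_dist v u
  cases p with
  | nil => exact absurd rfl h
  | @cons _ w _ hvw q =>
    refine ⟨w, hvw, ?_⟩
    have h1 : T.dist w u ≤ q.length := dist_le q
    have h2 : T.dist v u ≤ T.dist v w + T.dist w u := hT.dist_triangle
    have h3 : T.dist v w = 1 := dist_eq_one_iff_adj.2 hvw
    rw [Walk.length_cons] at hp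
    rw [T.dist_comm (u := u), T.dist_comm (u := u)]
    omega

theorem dist_eq_add_of_mem_support (hT : T.Connected) {u v w : V} {p : T.Walk u v}
    (hp : p.length = T.dist u v) (hw : w ∈ p.support) :
    T.dist u v = T.dist u w + T.dist w v := by
  classical
  have h1 := dist_le (p.takeUntil w hw)
  have h2 := dist_le (p.dropUntil w hw)
  have h3 := congrArg Walk.length (p.take_spec hw)
  rw [Walk.length_append] at h3
  have h4 : T.dist u v ≤ T.dist u w + T.dist w v := hT.dist_triangle
  omega

/-- Vertices on different sides of an edge of a tree are joined through that edge. -/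
theorem dist_eq_of_separated (hT : T.IsTree) {a b x z : V} (hab : T.Adj a b)
    (hx : T.dist x b = T.dist x a + 1) (hz : T.dist z a = T.dist z b + 1) :
    T.dist x z = T.dist x a + 1 + T.dist b z := by
  have hc := hT.connected
  have hbr : T.IsBridge s(a, b) := isAcyclic_iff_forall_adj_isBridge.1 hT.isAcyclic hab
  rw [isBridge_iff_forall_walk_mem_edges] at hbr
  obtain ⟨p, hp⟩ := hc.exists_walk_length_eq_dist a x
  obtain ⟨q, hq⟩ := hc.exists_walk_length_eq_dist x z
  obtain ⟨r, hr⟩ := hc.exists_walk_length_eq_dist z b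
  have hab1 : T.dist a b = 1 := dist_eq_one_iff_adj.2 hab
  have hmem := hbr (p.append (q.append r))
  rw [Walk.edges_append, Walk.edges_append, List.mem_append, List.mem_append] at hmem
  have hxa : T.dist a x = T.dist x a := dist_comm
  have hxb : T.dist b x = T.dist x b := dist_comm
  have hzb : T.dist b z = T.dist z b := dist_comm
  have hza : T.dist a z = T.dist z a := dist_comm
  have hba : T.dist b a = T.dist a b := dist_comm
  -- The closed-up walk a → x → z → b must cross the bridge. Its outer geodesics cannot, by the side
  -- conditions on x and z, so the geodesic from x to z does.
  rcases hmem with h | h | h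
  · have := dist_eq_add_of_mem_support hc hp (p.snd_mem_support_of_mem_edges h)
    omega
  · have := dist_eq_add_of_mem_support hc hq (q.fst_mem_support_of_mem_edges h)
    omega
  · have := dist_eq_add_of_mem_support hc hr (r.fst_mem_support_of_mem_edges h)
    omega

/-- The four point condition for trees. -/
theorem four_point (hT : T.IsTree) (x y z w : V) :
    T.dist x y + T.dist z w ≤ max (T.dist x z + T.dist y w) (T.dist x w + T.dist y z) := by
  have hc := hT.connected
  suffices H : ∀ w, T.dist x y + T.dist z w ≤
        max (T.dist x z + T.dist y w) (T.dist x w + T.dist y z) ∧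
      T.dist x z + T.dist y w ≤ max (T.dist x y + T.dist z w) (T.dist x w + T.dist y z) ∧
      T.dist x w + T.dist y z ≤ max (T.dist x y + T.dist z w) (T.dist x z + T.dist y w) from
    (H w).1
  intro w
  have step : ∀ a b : V, T.Adj a b →
      (T.dist x y + T.dist z a ≤
        max (T.dist x z + T.dist y a) (T.dist x a + T.dist y z) ∧
      T.dist x z + T.dist y a ≤ max (T.dist x y + T.dist z a) (T.dist x a + T.dist y z) ∧
      T.dist x a + T.dist y z ≤ max (T.dist x y + T.dist z a) (T.dist x z + T.dist y a)) →
      (T.dist x y + T.dist z b ≤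
        max (T.dist x z + T.dist y b) (T.dist x b + T.dist y z) ∧
      T.dist x z + T.dist y b ≤ max (T.dist x y + T.dist z b) (T.dist x b + T.dist y z) ∧
      T.dist x b + T.dist y z ≤ max (T.dist x y + T.dist z b) (T.dist x z + T.dist y b)) := by
    intro a b hab ih
    have txy : T.dist x y ≤ T.dist x a + T.dist a y := hc.dist_triangle
    have txz : T.dist x z ≤ T.dist x a + T.dist a z := hc.dist_triangle
    have tyz : T.dist y z ≤ T.dist y a + T.dist a z := hc.dist_triangle
    have txy' : T.dist x y ≤ T.dist x b + T.dist b y := hc.dist_triangle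
    have txz' : T.dist x z ≤ T.dist x b + T.dist b z := hc.dist_triangle
    have tyz' : T.dist y z ≤ T.dist y b + T.dist b z := hc.dist_triangle
    have cax : T.dist a x = T.dist x a := dist_comm
    have cay : T.dist a y = T.dist y a := dist_comm
    have caz : T.dist a z = T.dist z a := dist_comm
    have cbx : T.dist b x = T.dist x b := dist_comm
    have cby : T.dist b y = T.dist y b := dist_comm
    have cbz : T.dist b z = T.dist z b := dist_comm
    have cyx : T.dist y x = T.dist x y := dist_comm
    have czx : T.dist z x = T.dist x z := dist_comm
    have czy : T.dist z y = T.dist y z := dist_comm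
    have sxy := @dist_eq_of_separated V T hT a b x y hab
    have sxz := @dist_eq_of_separated V T hT a b x z hab
    have syz := @dist_eq_of_separated V T hT a b y z hab
    have syx := @dist_eq_of_separated V T hT a b y x hab
    have szx := @dist_eq_of_separated V T hT a b z x hab
    have szy := @dist_eq_of_separated V T hT a b z y hab
    -- Each of x, y, z lies on one side of the edge ab; distances between different sides are forced
    -- by separation, and the rest is arithmetic.
    rcases hT.dist_eq_dist_add_one_of_adj x hab with hx | hx <;>
    rcases hT.dist_eq_dist_add_one_of_adj y hab with hy | hy <;>
    rcases hT.dist_eq_dist_add_one_of_adj z hab with hz | hz <;>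
    simp only [hx, hy, hz, forall_const] at * <;> omega
  have key : ∀ a b : V, T.Walk a b →
      (T.dist x y + T.dist z a ≤
        max (T.dist x z + T.dist y a) (T.dist x a + T.dist y z) ∧
      T.dist x z + T.dist y a ≤ max (T.dist x y + T.dist z a) (T.dist x a + T.dist y z) ∧
      T.dist x a + T.dist y z ≤ max (T.dist x y + T.dist z a) (T.dist x z + T.dist y a)) →
      (T.dist x y + T.dist z b ≤
        max (T.dist x z + T.dist y b) (T.dist x b + T.dist y z) ∧
      T.dist x z + T.dist y b ≤ max (T.dist x y + T.dist z b) (T.dist x b + T.dist y z) ∧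
      T.dist x b + T.dist y z ≤ max (T.dist x y + T.dist z b) (T.dist x z + T.dist y b)) := by
    intro a b p
    induction p with
    | nil => exact id
    | cons h _ ih => exact fun h0 => ih (step _ _ h h0)
  obtain ⟨p⟩ := hc x w
  refine key x w p ?_
  have cyx : T.dist y x = T.dist x y := dist_comm
  have czx : T.dist z x = T.dist x z := dist_comm
  have tyz : T.dist y z ≤ T.dist y x + T.dist x z := hc.dist_triangle
  simp only [dist_self]
  omega

theorem even_dist_add (hT : T.IsTree) (x y z : V) :
    Even (T.dist x y + T.dist x z + T.dist y z) := by
  obtain ⟨p⟩ := hT.connected y z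
  induction p with
  | nil => simp
  | @cons a b c h _ ih =>
    have h1 := hT.dist_eq_dist_add_one_of_adj x h
    have h2 := hT.dist_eq_dist_add_one_of_adj c h
    have c1 : T.dist a c = T.dist c a := dist_comm
    have c2 : T.dist b c = T.dist c b := dist_comm
    grind

end TreeMetric

/-! ### Unordered pairs against ordered pairs. -/

theorem sum_filter_mk_mem {α M : Type*} [Fintype α] [DecidableEq α] [AddCommMonoid M]
    (S : Finset (Sym2 α)) (hS : ∀ e ∈ S, ¬ e.IsDiag) (g : α → α → M) :
    ∑ p : α × α with s(p.1, p.2) ∈ S, g p.1 p.2 =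
      ∑ e ∈ S, Sym2.lift ⟨fun a b => g a b + g b a, fun _ _ => add_comm _ _⟩ e := by
  rw [← Finset.sum_fiberwise_of_maps_to (s := Finset.univ.filter fun p : α × α => s(p.1, p.2) ∈ S)
    (t := S) (g := fun p => s(p.1, p.2)) (by simp)]
  refine Finset.sum_congr rfl fun e he => ?_
  induction e with
  | _ a b =>
    have hab : a ≠ b := fun h => hS _ he (Sym2.mk_isDiag_iff.2 h)
    have : (Finset.univ.filter fun p : α × α => s(p.1, p.2) ∈ S).filter
        (fun p => s(p.1, p.2) = s(a, b)) = {(a, b), (b, a)} := by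
      ext ⟨c, d⟩
      simp only [Finset.mem_filter, Finset.mem_univ, true_and, Sym2.eq_iff, Finset.mem_insert,
        Finset.mem_singleton, Prod.mk.injEq]
      constructor
      · exact fun h => h.2
      · rintro (⟨rfl, rfl⟩ | ⟨rfl, rfl⟩)
        · exact ⟨he, by simp⟩
        · exact ⟨by rwa [Sym2.eq_swap], by simp⟩
    rw [this, Finset.sum_pair (by simp [hab])]
    rfl

theorem two_mul_pairSum {α : Type*} [Fintype α] [DecidableEq α] (f : α → α → ℕ)
    (hf : ∀ x y, f x y = f y x) :
    2 * pairSum f hf = ∑ x, ∑ y, if x = y then 0 else f x y := by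
  rw [pairSum, Finset.mul_sum, ← Fintype.sum_prod_type' (fun x y => if x = y then 0 else f x y)]
  have h := sum_filter_mk_mem (Finset.univ.filter fun p : Sym2 α => ¬ p.IsDiag) (by simp)
    (fun a b => f a b)
  rw [Finset.sum_filter] at h
  simp only [Finset.mem_filter, Finset.mem_univ, true_and, Sym2.mk_isDiag_iff] at h
  trans ∑ e : Sym2 α with ¬ e.IsDiag,
    Sym2.lift ⟨fun a b => f a b + f b a, fun _ _ => add_comm _ _⟩ e
  · refine Finset.sum_congr rfl fun e _ => ?_
    induction e with
    | _ a b => simp only [Sym2.lift_mk, hf b a]; ring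
  · rw [← h]
    refine Finset.sum_congr rfl fun p _ => ?_
    by_cases h : p.1 = p.2 <;> simp [h]

/-- The sum of all distances, over ordered pairs of vertices. -/
noncomputable def totalDist {V : Type*} [Fintype V] (G : SimpleGraph V) : ℕ :=
  ∑ u, ∑ v, G.dist u v

/-! ### Edge and degree sums of a tree in terms of distances. -/

section Edges

variable {V : Type*} [Fintype V] {T : SimpleGraph V}

open Classical in
theorem sum_degree_mul (G : SimpleGraph V) (g : V → ℕ) :
    ∑ v, G.degree v * g v =
      ∑ e ∈ G.edgeFinset, Sym2.lift ⟨fun a b => g a + g b, fun _ _ => add_comm _ _⟩ e := by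
  rw [← sum_filter_mk_mem G.edgeFinset
    (fun e he => G.not_isDiag_of_mem_edgeFinset he) (fun a _ => g a), Finset.sum_filter]
  simp only [mem_edgeFinset, mem_edgeSet]
  rw [Fintype.sum_prod_type' (fun x y => if G.Adj x y then g x else 0)]
  refine Finset.sum_congr rfl fun v _ => ?_
  rw [← Finset.sum_filter, Finset.sum_const, smul_eq_mul, ← card_neighborFinset_eq_degree,
    neighborFinset_eq_filter]

omit [Fintype V] in
theorem dist_add_dist_of_mem (hT : T.IsTree) (u : V) {e : Sym2 V} (he : e ∈ T.edgeSet) :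
    Sym2.lift ⟨fun a b => T.dist u a + T.dist u b, fun _ _ => add_comm _ _⟩ e =
      2 * vertexEdgeDist T u e + 1 := by
  induction e with
  | _ a b =>
    have : T.dist u a = T.dist u b + 1 ∨ T.dist u b = T.dist u a + 1 :=
      hT.dist_eq_dist_add_one_of_adj u he
    simp only [vertexEdgeDist, Sym2.lift_mk]
    omega

open Classical in
-- Root the tree at u. Sending each v ≠ u to the edge towards its parent is a bijection onto the
-- edges, and that edge is one step closer to u than v is.
theorem sum_vertexEdgeDist_add_one (hT : T.IsTree) (u : V) :
    ∑ e ∈ T.edgeFinset, (vertexEdgeDist T u e + 1) = ∑ v, T.dist u v := by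
  choose! par hadj hpar using fun v (h : v ≠ u) => exists_adj_closer hT.connected h
  have hinj : Set.InjOn (fun v => s(v, par v)) ((Finset.univ.erase u : Finset V) : Set V) := by
    intro v hv w hw h
    have hv' : v ≠ u := by simpa using hv
    have hw' : w ≠ u := by simpa using hw
    rcases Sym2.eq_iff.1 h with h | h
    · exact h.1
    · have h1 := hpar v hv'
      have h2 := hpar w hw'
      rw [h.2, h.1] at h1
      rw [← h.1] at h2
      rw [h.1] at h2
      omega
  have himg : (Finset.univ.erase u).image (fun v => s(v, par v)) = T.edgeFinset := by
    refine Finset.eq_of_subset_of_card_le ?_ ?_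
    · intro e he
      obtain ⟨v, hv, rfl⟩ := Finset.mem_image.1 he
      exact mem_edgeFinset.2 (hadj v (by simpa using hv))
    · rw [Finset.card_image_of_injOn hinj, Finset.card_erase_of_mem (Finset.mem_univ u),
        Finset.card_univ]
      have := hT.card_edgeFinset
      omega
  rw [← himg, Finset.sum_image hinj, ← Finset.add_sum_erase _ _ (Finset.mem_univ u), dist_self,
    zero_add]
  refine Finset.sum_congr rfl fun v hv => ?_
  have := hpar v (by simpa using hv)
  simp only [vertexEdgeDist, Sym2.lift_mk]
  omega

open Classical in
theorem sum_vertexEdgeDist_add_card (hT : T.IsTree) (u : V) :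
    ∑ e ∈ T.edgeFinset, vertexEdgeDist T u e + Fintype.card V = ∑ v, T.dist u v + 1 := by
  rw [← sum_vertexEdgeDist_add_one hT u, Finset.sum_add_distrib, ← hT.card_edgeFinset]
  simp [add_assoc]

open Classical in
theorem sum_degree_mul_dist (hT : T.IsTree) (u : V) :
    ∑ v, T.degree v * T.dist u v + Fintype.card V = 2 * ∑ v, T.dist u v + 1 := by
  have h1 := sum_degree_mul T (fun v => T.dist u v)
  rw [Finset.sum_congr rfl fun e he => dist_add_dist_of_mem hT u (mem_edgeFinset.1 he),
    Finset.sum_add_distrib, ← Finset.mul_sum] at h1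
  have h2 := sum_vertexEdgeDist_add_card hT u
  have h3 := hT.card_edgeFinset
  simp only [Finset.sum_const, smul_eq_mul, mul_one] at h1
  omega

open Classical in
theorem sum_degree_add_two (hT : T.IsTree) : ∑ v, T.degree v + 2 = 2 * Fintype.card V := by
  have := T.sum_degrees_eq_twice_card_edges
  have := hT.card_edgeFinset
  omega

open Classical in
theorem sum_sum_degree_mul_dist (hT : T.IsTree) :
    ∑ u, T.degree u * ∑ v, T.dist u v + Fintype.card V * Fintype.card V =
      2 * totalDist T + Fintype.card V := by
  have h : ∑ u, (∑ v, T.degree v * T.dist u v + Fintype.card V) =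
      ∑ u, (2 * ∑ v, T.dist u v + 1) :=
    Finset.sum_congr rfl fun u _ => sum_degree_mul_dist hT u
  rw [Finset.sum_add_distrib, Finset.sum_add_distrib, Finset.sum_comm, ← Finset.mul_sum] at h
  simp only [← Finset.mul_sum, T.dist_comm, Finset.sum_const, Finset.card_univ, smul_eq_mul,
    mul_one] at h
  exact h

theorem schultz_eq (hT : T.IsTree) :
    schultz T + Fintype.card V * Fintype.card V = 2 * totalDist T + Fintype.card V := by
  classical
  rw [← sum_sum_degree_mul_dist hT]
  have h := two_mul_pairSum (fun u v => T.dist u v * (T.degree u + T.degree v))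
    (fun u v => by rw [T.dist_comm, Nat.add_comm])
  have h2 : ∑ u, ∑ v, (if u = v then 0 else T.dist u v * (T.degree u + T.degree v)) =
      2 * ∑ u, T.degree u * ∑ v, T.dist u v := by
    have h3 : ∀ u v, (if u = v then 0 else T.dist u v * (T.degree u + T.degree v)) =
        T.degree u * T.dist u v + T.degree v * T.dist v u := by
      intro u v
      split_ifs with huv
      · simp [huv]
      · rw [T.dist_comm (u := v)]; ring
    simp only [h3, Finset.sum_add_distrib]
    rw [Finset.sum_comm (f := fun u v => T.degree v * T.dist v u), ← two_mul]
    simp only [Finset.mul_sum]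
  rw [h2] at h
  have : schultz T = ∑ u, T.degree u * ∑ v, T.dist u v := by
    have : schultz T = pairSum (fun u v => T.dist u v * (T.degree u + T.degree v))
      (fun u v => by rw [T.dist_comm, Nat.add_comm]) := by
        unfold schultz; congr!
    omega
  rw [this]

theorem gutman_eq (hT : T.IsTree) :
    gutman T + 2 * (Fintype.card V * Fintype.card V) =
      2 * totalDist T + 3 * Fintype.card V - 1 := by
  classical
  have h := two_mul_pairSum (fun u v => T.dist u v * (T.degree u * T.degree v))
    (fun u v => by rw [T.dist_comm, Nat.mul_comm (T.degree u)])
  have h2 : ∑ u, ∑ v, (if u = v then 0 else T.dist u v * (T.degree u * T.degree v)) =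
      ∑ u, T.degree u * ∑ v, T.degree v * T.dist u v := by
    refine Finset.sum_congr rfl fun u _ => ?_
    rw [Finset.mul_sum]
    refine Finset.sum_congr rfl fun v _ => ?_
    split_ifs with huv
    · simp [huv]
    · ring
  have h3 : ∑ u, T.degree u * (∑ v, T.degree v * T.dist u v + Fintype.card V) =
      ∑ u, T.degree u * (2 * ∑ v, T.dist u v + 1) :=
    Finset.sum_congr rfl fun u _ => by rw [sum_degree_mul_dist hT u]
  simp only [mul_add, Finset.sum_add_distrib, ← Finset.sum_mul, mul_one,
    mul_left_comm _ 2, ← Finset.mul_sum] at h3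
  have h4 := sum_sum_degree_mul_dist hT
  have h5 := sum_degree_add_two hT
  have h6 : gutman T = pairSum (fun u v => T.dist u v * (T.degree u * T.degree v))
      (fun u v => by rw [T.dist_comm, Nat.mul_comm (T.degree u)]) := by
    unfold gutman; congr!
  have h7 := congrArg (· * Fintype.card V) h5
  simp only [add_mul, mul_assoc] at h7
  rw [h2] at h
  omega

open Classical in
theorem sum_sum_vertexEdgeDist (hT : T.IsTree) :
    ∑ v, ∑ e ∈ T.edgeFinset, vertexEdgeDist T v e + Fintype.card V * Fintype.card V =
      totalDist T + Fintype.card V := by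
  have h : ∑ v, (∑ e ∈ T.edgeFinset, vertexEdgeDist T v e + Fintype.card V) =
      ∑ v, (∑ w, T.dist v w + 1) :=
    Finset.sum_congr rfl fun u _ => sum_vertexEdgeDist_add_card hT u
  simpa [Finset.sum_add_distrib, totalDist] using h

omit [Fintype V] in
theorem edgeDist_self (G : SimpleGraph V) (e : Sym2 V) : edgeDist G e e = 0 := by
  induction e with
  | _ a b => simp [edgeDist, vertexEdgeDist]

omit [Fintype V] in
-- The distances from the two ends of an edge to a different edge differ by exactly one, so their
-- sum is twice the minimum plus one.
theorem two_mul_edgeDist_add_one (hT : T.IsTree) {a b : V} {f : Sym2 V} (hab : T.Adj a b)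
    (hf : f ∈ T.edgeSet) (hne : f ≠ s(a, b)) :
    2 * edgeDist T s(a, b) f + 1 = vertexEdgeDist T a f + vertexEdgeDist T b f := by
  induction f with
  | _ c d =>
    simp only [edgeDist, vertexEdgeDist, Sym2.lift_mk]
    have hab1 : T.dist a b = 1 := dist_eq_one_iff_adj.2 hab
    have hcd1 : T.dist c d = 1 := dist_eq_one_iff_adj.2 hf
    have h1 := hT.dist_eq_dist_add_one_of_adj a hf
    have h2 := hT.dist_eq_dist_add_one_of_adj b hf
    have h3 := hT.dist_eq_dist_add_one_of_adj c hab
    have h4 := hT.dist_eq_dist_add_one_of_adj d hab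
    rw [T.dist_comm (u := c), T.dist_comm (u := c)] at h3
    rw [T.dist_comm (u := d), T.dist_comm (u := d)] at h4
    have q1 := four_point hT a c b d
    have q2 := four_point hT a d b c
    -- The four point condition leaves only the coincidence of the two edges, in one of two
    -- orientations; `e1` and `e2` exclude it.
    have e1 : T.dist b d = T.dist a c → T.dist a c ≠ 0 := by
      intro h h0
      rw [h0] at h
      have := hT.connected.dist_eq_zero_iff.1 h0
      have := hT.connected.dist_eq_zero_iff.1 h
      subst_vars
      exact hne rfl
    have e2 : T.dist b c = T.dist a d → T.dist a d ≠ 0 := by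
      intro h h0
      rw [h0] at h
      have := hT.connected.dist_eq_zero_iff.1 h0
      have := hT.connected.dist_eq_zero_iff.1 h
      subst_vars
      exact hne Sym2.eq_swap
    rw [T.dist_comm (u := c) (v := b)] at q1
    rw [T.dist_comm (u := d) (v := b), T.dist_comm (u := d) (v := c)] at q2
    omega

open Classical in
theorem sum_edgeDist (hT : T.IsTree) {e : Sym2 V} (he : e ∈ T.edgeSet) :
    2 * ∑ f ∈ T.edgeFinset, edgeDist T e f + Fintype.card V =
      Sym2.lift ⟨fun a b => ∑ f ∈ T.edgeFinset, vertexEdgeDist T a f +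
        ∑ f ∈ T.edgeFinset, vertexEdgeDist T b f, fun _ _ => add_comm _ _⟩ e + 2 := by
  induction e with
  | _ a b =>
    have hmem : s(a, b) ∈ T.edgeFinset := mem_edgeFinset.2 he
    -- The edge itself violates the relation (its terms are all 0), so it is removed before summing.
    have h : ∑ f ∈ T.edgeFinset.erase s(a, b), (2 * edgeDist T s(a, b) f + 1) =
        ∑ f ∈ T.edgeFinset.erase s(a, b), (vertexEdgeDist T a f + vertexEdgeDist T b f) :=
      Finset.sum_congr rfl fun f hf => by
        rw [Finset.mem_erase] at hf
        exact two_mul_edgeDist_add_one hT he (mem_edgeFinset.1 hf.2) hf.1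
    have h1 := Finset.add_sum_erase _ (fun f => edgeDist T s(a, b) f) hmem
    have h2 := Finset.add_sum_erase _ (fun f => vertexEdgeDist T a f + vertexEdgeDist T b f) hmem
    have h3 : vertexEdgeDist T a s(a, b) + vertexEdgeDist T b s(a, b) = 0 := by
      simp [vertexEdgeDist]
    rw [edgeDist_self] at h1
    rw [h3] at h2
    rw [Finset.sum_add_distrib, ← Finset.mul_sum, Finset.sum_const, smul_eq_mul, mul_one,
      Finset.card_erase_of_mem hmem] at h
    have h4 := hT.card_edgeFinset
    have h5 := Finset.card_pos.2 ⟨_, hmem⟩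
    simp only [Sym2.lift_mk]
    simp only [Finset.sum_add_distrib] at h h2
    omega

open Classical in
theorem two_mul_edgeWiener (G : SimpleGraph V) :
    2 * edgeWiener G = ∑ e ∈ G.edgeFinset, ∑ f ∈ G.edgeFinset, edgeDist G e f := by
  have h := two_mul_pairSum (α := G.edgeSet) (fun e f => edgeDist G e f)
    fun e f => edgeDist_comm G e f
  have h2 : edgeWiener G = pairSum (α := G.edgeSet) (fun e f => edgeDist G e f)
    fun e f => edgeDist_comm G e f := by
    unfold edgeWiener; congr!
  have h3 : ∀ e f : G.edgeSet, (if e = f then 0 else edgeDist G e f) = edgeDist G e f := by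
    intro e f
    split_ifs with hef
    · rw [hef, edgeDist_self]
    · rfl
  have h4 : ∀ g : Sym2 V → ℕ, ∑ e ∈ G.edgeFinset, g e = ∑ e : G.edgeSet, g e :=
    fun g => Finset.sum_subtype _ (fun x => by simp) g
  simp only [h2, h, h3, h4]

open Classical in
theorem edgeWiener_eq (hT : T.IsTree) :
    4 * edgeWiener T + 4 * (Fintype.card V * Fintype.card V) + 4 =
      2 * totalDist T + 8 * Fintype.card V := by
  have h : ∑ e ∈ T.edgeFinset, (2 * ∑ f ∈ T.edgeFinset, edgeDist T e f + Fintype.card V) =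
      ∑ e ∈ T.edgeFinset, (Sym2.lift ⟨fun a b => ∑ f ∈ T.edgeFinset, vertexEdgeDist T a f +
        ∑ f ∈ T.edgeFinset, vertexEdgeDist T b f, fun _ _ => add_comm _ _⟩ e + 2) :=
    Finset.sum_congr rfl fun e he => sum_edgeDist hT (mem_edgeFinset.1 he)
  rw [Finset.sum_add_distrib, Finset.sum_add_distrib, ← sum_degree_mul, ← Finset.mul_sum,
    ← two_mul_edgeWiener] at h
  have h2 : ∑ v, T.degree v * (∑ e ∈ T.edgeFinset, vertexEdgeDist T v e + Fintype.card V) =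
      ∑ v, T.degree v * (∑ w, T.dist v w + 1) :=
    Finset.sum_congr rfl fun v _ => by rw [sum_vertexEdgeDist_add_card hT v]
  simp only [mul_add, Finset.sum_add_distrib, ← Finset.sum_mul, mul_one] at h2
  have h3 := sum_sum_degree_mul_dist hT
  have h4 := sum_degree_add_two hT
  have h5 := hT.card_edgeFinset
  have h6 := congrArg (· * Fintype.card V) h4
  have h7 := congrArg (· * Fintype.card V) h5
  simp only [add_mul, mul_assoc, one_mul] at h6 h7
  simp only [Finset.sum_const, smul_eq_mul] at h
  omega

end Edges

/-! ### Distances in the line graph. -/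

section LineGraph

variable {V : Type*} {G : SimpleGraph V}

theorem edgeDist_le_dist (G : SimpleGraph V) {e f : Sym2 V} {a c : V} (ha : a ∈ e) (hc : c ∈ f) :
    edgeDist G e f ≤ G.dist a c := by
  induction e with
  | _ x y =>
    induction f with
    | _ z w =>
      simp only [edgeDist, vertexEdgeDist, Sym2.lift_mk]
      rcases Sym2.mem_iff.1 ha with rfl | rfl <;> rcases Sym2.mem_iff.1 hc with rfl | rfl <;> omega

theorem exists_edgeDist_eq_dist (G : SimpleGraph V) (e f : Sym2 V) :
    ∃ a ∈ e, ∃ c ∈ f, edgeDist G e f = G.dist a c := by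
  induction e with
  | _ x y =>
    induction f with
    | _ z w =>
      simp only [edgeDist, vertexEdgeDist, Sym2.lift_mk]
      rcases min_choice (min (G.dist x z) (G.dist x w)) (min (G.dist y z) (G.dist y w)) with
        h | h <;> rw [h]
      · rcases min_choice (G.dist x z) (G.dist x w) with h | h <;> rw [h]
        · exact ⟨x, by simp, z, by simp, rfl⟩
        · exact ⟨x, by simp, w, by simp, rfl⟩
      · rcases min_choice (G.dist y z) (G.dist y w) with h | h <;> rw [h]
        · exact ⟨y, by simp, z, by simp, rfl⟩
        · exact ⟨y, by simp, w, by simp, rfl⟩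

theorem exists_lineGraph_walk_of_mem {e f : G.edgeSet} {a : V} (he : a ∈ (e : Sym2 V))
    (hf : a ∈ (f : Sym2 V)) : ∃ q : G.lineGraph.Walk e f, q.length ≤ 1 := by
  by_cases h : e = f
  · subst h
    exact ⟨Walk.nil, by simp⟩
  · exact ⟨(lineGraph_adj_iff_exists.2 ⟨h, a, he, hf⟩).toWalk, by simp⟩

theorem exists_lineGraph_walk {a c : V} (p : G.Walk a c) (f : G.edgeSet)
    (hf : c ∈ (f : Sym2 V)) (e : G.edgeSet) (he : a ∈ (e : Sym2 V)) :
    ∃ q : G.lineGraph.Walk e f, q.length ≤ p.length + 1 := by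
  induction p generalizing e with
  | nil =>
    obtain ⟨q, hq⟩ := exists_lineGraph_walk_of_mem he hf
    exact ⟨q, by simpa using hq⟩
  | @cons x y z h p ih =>
    obtain ⟨q₁, h₁⟩ := exists_lineGraph_walk_of_mem (f := ⟨s(x, y), h⟩) he (by simp)
    obtain ⟨q₂, h₂⟩ := ih hf ⟨s(x, y), h⟩ (by simp)
    refine ⟨q₁.append q₂, ?_⟩
    rw [Walk.length_append, Walk.length_cons]
    omega

theorem edgeDist_le_of_lineGraph_adj (hG : G.Connected) {f f' : G.edgeSet} (e : Sym2 V)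
    (h : G.lineGraph.Adj f f') : edgeDist G f e ≤ edgeDist G f' e + 1 := by
  obtain ⟨-, v, hv, hv'⟩ := lineGraph_adj_iff_exists.1 h
  obtain ⟨a, ha, c, hc, hac⟩ := exists_edgeDist_eq_dist G f' e
  have h1 := edgeDist_le_dist G hv hc
  have h2 : G.dist v c ≤ G.dist v a + G.dist a c := hG.dist_triangle
  have h3 : G.dist v a ≤ 1 := by
    by_cases hva : v = a
    · simp [hva]
    · have : (f' : Sym2 V) = s(v, a) := (Sym2.mem_and_mem_iff hva).1 ⟨hv', ha⟩
      have hadj : G.Adj v a := by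
        have h' := f'.2
        rwa [this] at h'
      exact (dist_eq_one_iff_adj.2 hadj).le
  omega

theorem edgeDist_add_one_le_length (hG : G.Connected) {e f : G.edgeSet}
    (p : G.lineGraph.Walk e f) (hne : e ≠ f) : edgeDist G e f + 1 ≤ p.length := by
  induction p with
  | nil => exact absurd rfl hne
  | @cons e g f h p ih =>
    rw [Walk.length_cons]
    by_cases hgf : g = f
    · subst hgf
      obtain ⟨-, v, hv, hv'⟩ := lineGraph_adj_iff_exists.1 h
      have := edgeDist_le_dist G hv hv'
      rw [dist_self] at this
      omega
    · have := edgeDist_le_of_lineGraph_adj hG f h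
      have := ih hgf
      omega

/-- A geodesic between nearest endpoints gives a walk of edges one step longer. Conversely, a step
in the line graph lowers `edgeDist` by at most one, and edges adjacent there already have `edgeDist`
0. -/
theorem lineGraph_dist (hG : G.Connected) {e f : G.edgeSet} (hne : e ≠ f) :
    G.lineGraph.dist e f = edgeDist G e f + 1 := by
  obtain ⟨a, ha, c, hc, hac⟩ := exists_edgeDist_eq_dist G e f
  obtain ⟨p, hp⟩ := hG.exists_walk_length_eq_dist a c
  obtain ⟨q, hq⟩ := exists_lineGraph_walk p f hc e ha
  obtain ⟨r, hr⟩ := q.reachable.exists_walk_length_eq_dist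
  have h1 := edgeDist_add_one_le_length hG r hne
  have h2 := dist_le q
  omega

end LineGraph

/-! ### The five indices as affine functions of the total distance. -/

section Index

variable {V : Type*} [Fintype V] {T : SimpleGraph V}

open Classical in
theorem edgeWiener'_eq (hT : T.IsTree) :
    2 * edgeWiener' T + 3 * Fintype.card V =
      2 * edgeWiener T + Fintype.card V * Fintype.card V + 2 := by
  have h := two_mul_pairSum (α := T.edgeSet) (fun e f => T.lineGraph.dist e f)
    fun _ _ => T.lineGraph.dist_comm
  have h1 := two_mul_pairSum (α := T.edgeSet) (fun e f => edgeDist T e f)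
    fun e f => edgeDist_comm T e f
  have h2 : edgeWiener T = pairSum (α := T.edgeSet) (fun e f => edgeDist T e f)
    fun e f => edgeDist_comm T e f := by
    unfold edgeWiener; congr!
  have h2' : edgeWiener' T = pairSum (α := T.edgeSet) (fun e f => T.lineGraph.dist e f)
    fun _ _ => T.lineGraph.dist_comm := by
    unfold edgeWiener'; congr!
  -- Adding 1 on the diagonal makes the excess equal to 1 for all ordered pairs of edges, so it sums
  -- to (n - 1)².
  have h3 : ∀ e f : T.edgeSet, (if e = f then 0 else T.lineGraph.dist e f) +
      (if e = f then 1 else 0) = (if e = f then 0 else edgeDist T e f) + 1 := by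
    intro e f
    split_ifs with hef
    · rfl
    · rw [lineGraph_dist hT.connected hef]
  have h4 : ∑ e : T.edgeSet, ∑ f : T.edgeSet, ((if e = f then 0 else T.lineGraph.dist e f) +
      (if e = f then 1 else 0)) = ∑ e : T.edgeSet, ∑ f : T.edgeSet,
        ((if e = f then 0 else edgeDist T e f) + 1) := by
    simp only [h3]
  simp only [Finset.sum_add_distrib, ← h, ← h1, ← h2, ← h2', Finset.sum_ite_eq, Finset.mem_univ,
    if_true, Finset.sum_const, Finset.card_univ, smul_eq_mul, mul_one] at h4
  have h5 := hT.card_edgeFinset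
  rw [edgeFinset_card] at h5
  rw [← h5]
  linarith

/-- The coefficient of the total distance in an index of a tree. -/
def WienerVariant.coeff : WienerVariant → ℚ
  | .edge' => 1 / 2
  | .edge => 1 / 2
  | .vertexEdge => 1 / 2
  | .schultz => 2
  | .gutman => 2

/-- The part of an index of a tree that depends only on the order of the tree. -/
def WienerVariant.offset : WienerVariant → ℚ → ℚ
  | .edge', n => - (n * (n - 1)) / 2
  | .edge, n => - (n - 1) ^ 2
  | .vertexEdge, n => - (n * (n - 1)) / 2
  | .schultz, n => - (n * (n - 1))
  | .gutman, n => - (2 * n - 1) * (n - 1)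

theorem WienerVariant.coeff_pos (I : WienerVariant) : 0 < I.coeff := by
  cases I <;> norm_num [WienerVariant.coeff]

theorem WienerVariant.index_eq (I : WienerVariant) (hT : T.IsTree) :
    I.index T = I.coeff * totalDist T + I.offset (Fintype.card V) := by
  classical
  have h1 : ((EccTree.schultz T + Fintype.card V * Fintype.card V : ℕ) : ℚ) =
      (2 * totalDist T + Fintype.card V : ℕ) := congrArg _ (schultz_eq hT)
  have h2' := gutman_eq hT
  have : Nonempty V := hT.connected.nonempty
  have hpos : 0 < Fintype.card V := Fintype.card_pos
  have h2 : ((EccTree.gutman T + 2 * (Fintype.card V * Fintype.card V) + 1 : ℕ) : ℚ) =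
      (2 * totalDist T + 3 * Fintype.card V : ℕ) := congrArg _ (by omega)
  have h3 : ((∑ v, ∑ e ∈ T.edgeFinset, vertexEdgeDist T v e +
      Fintype.card V * Fintype.card V : ℕ) : ℚ) = (totalDist T + Fintype.card V : ℕ) :=
    congrArg _ (sum_sum_vertexEdgeDist hT)
  have h4 : ((4 * edgeWiener T + 4 * (Fintype.card V * Fintype.card V) + 4 : ℕ) : ℚ) =
      (2 * totalDist T + 8 * Fintype.card V : ℕ) := congrArg _ (edgeWiener_eq hT)
  have h5 : ((2 * edgeWiener' T + 3 * Fintype.card V : ℕ) : ℚ) =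
      (2 * edgeWiener T + Fintype.card V * Fintype.card V + 2 : ℕ) :=
    congrArg _ (edgeWiener'_eq hT)
  push_cast at h1 h2 h3 h4 h5
  cases I <;> simp only [WienerVariant.index, WienerVariant.coeff, WienerVariant.offset]
  · linarith
  · linarith
  · have h6 : vertexEdgeWiener T =
        (1 / 2 : ℚ) * ∑ v : V, ∑ e ∈ T.edgeFinset, (vertexEdgeDist T v e : ℚ) := by
      unfold vertexEdgeWiener; congr!
    linarith
  · linarith
  · linarith

end Index

/-! ### Coordinates along a diametral path. -/

/-- The truncated absolute difference of natural numbers. -/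
abbrev gap (a b : ℕ) : ℕ := (a - b) + (b - a)

/-- A diametral path `v 0, …, v D` of a tree, together with the position `pos x` at which each
vertex `x` hangs off the path and its distance `ht x` from the path. -/
structure Spine {V : Type*} (T : SimpleGraph V) (D : ℕ) where
  v : ℕ → V
  pos : V → ℕ
  ht : V → ℕ
  pos_v : ∀ i ≤ D, pos (v i) = i
  ht_v : ∀ i ≤ D, ht (v i) = 0
  v_pos : ∀ x, ht x = 0 → v (pos x) = x
  ht_le : ∀ x, ht x ≤ pos x
  ht_add_le : ∀ x, ht x + pos x ≤ D
  dist_of_ne : ∀ x y, pos x ≠ pos y → T.dist x y = ht x + ht y + gap (pos x) (pos y)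
  dist_le : ∀ x y, pos x = pos y → T.dist x y ≤ ht x + ht y
  le_dist : ∀ x y, pos x = pos y → ht x ≤ T.dist x y + ht y
  even_dist : ∀ x y, pos x = pos y → Even (T.dist x y + ht x + ht y)
  eq_of_dist : ∀ x x' y, pos x = pos y → pos x' = pos y → ht x = ht x' →
    T.dist x y + ht x = ht y → T.dist x' y + ht x' = ht y → x = x'

namespace Spine

variable {V : Type*} {T : SimpleGraph V} {D : ℕ}

/-- The coordinates are read off from the distances to the two ends a, b of the path; the four point
condition and parity then yield every field. -/
theorem nonempty_of_isTree [Finite V] (hT : T.IsTree) : Nonempty (Spine T T.diam) := by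
  have hc := hT.connected
  have : Nonempty V := hc.nonempty
  obtain ⟨a, b, hab⟩ := T.exists_dist_eq_diam
  have hle : ∀ x y, T.dist x y ≤ T.diam := fun x y =>
    dist_le_diam (connected_iff_ediam_ne_top.1 hc)
  obtain ⟨p, hp⟩ := hc.exists_walk_length_eq_dist a b
  generalize T.diam = D at *
  have tri : ∀ x y z, T.dist x z ≤ T.dist x y + T.dist y z := fun _ _ _ => hc.dist_triangle
  have hva : ∀ i ≤ D, T.dist a (p.getVert i) = i ∧ T.dist (p.getVert i) b = D - i := by
    intro i hi
    have h1 := SimpleGraph.dist_le (p.take i)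
    have h2 := SimpleGraph.dist_le (p.drop i)
    rw [Walk.take_length] at h1
    rw [Walk.drop_length] at h2
    have h3 := tri a (p.getVert i) b
    omega
  set v := p.getVert with hv
  -- Solutions of d(a,x) = ht + pos and d(x,b) = ht + D - pos. Parity makes the halves exact, and
  -- the bound by the diameter and the triangle inequality make the subtractions genuine.
  let pos : V → ℕ := fun x => (T.dist a x + D - T.dist x b) / 2
  let ht : V → ℕ := fun x => (T.dist a x + T.dist x b - D) / 2
  have hdef : ∀ x, T.dist a x = ht x + pos x ∧ T.dist x b + pos x = ht x + D := by
    intro x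
    obtain ⟨k, hk⟩ := even_dist_add hT a x b
    have h1 := tri a x b
    have h2 := tri x a b
    rw [T.dist_comm (u := x) (v := a)] at h2
    have h3 := hle x b
    simp only [pos, ht]
    omega
  have hdist : ∀ x, ∀ k ≤ D, T.dist x (v k) = ht x + gap (pos x) k := by
    intro x k hk
    have h1 := hdef x
    have h2 := hva k hk
    have h3 := four_point hT x (v k) a b
    have h4 := four_point hT x a (v k) b
    have h5 := four_point hT x b (v k) a
    have h6 := tri a (v k) x
    simp only [T.dist_comm (v := a), T.dist_comm (u := b), T.dist_comm (u := v k) (v := x)]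
      at h3 h4 h5 h6
    simp only [gap]
    omega
  have hpv : ∀ i ≤ D, pos (v i) = i ∧ ht (v i) = 0 := by
    intro i hi
    have h1 := hdef (v i)
    have h2 := hva i hi
    omega
  have hposD : ∀ x, ht x + pos x ≤ D := fun x => by
    have := hle a x
    have := hdef x
    omega
  refine ⟨⟨v, pos, ht, fun i hi => (hpv i hi).1, fun i hi => (hpv i hi).2, ?_, ?_, hposD, ?_, ?_,
    ?_, ?_, ?_⟩⟩
  · intro x hx
    have h1 := hdist x (pos x) (by have := hposD x; omega)
    have : T.dist x (v (pos x)) = 0 := by simp only [gap] at h1; omega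
    exact (hc.dist_eq_zero_iff.1 this).symm
  · intro x
    have := hle x b
    have := hdef x
    omega
  · intro x y hxy
    have hx := hposD x
    have hy := hposD y
    have h1 := hdist x (pos x) (by omega)
    have h2 := hdist x (pos y) (by omega)
    have h3 := hdist y (pos x) (by omega)
    have h4 := hdist y (pos y) (by omega)
    have h5 := hdist (v (pos x)) (pos y) (by omega)
    have h6 := hpv (pos x) (by omega)
    have h7 := four_point hT x y (v (pos x)) (v (pos y))
    have h8 := four_point hT x (v (pos y)) y (v (pos x))
    rw [T.dist_comm (u := v (pos y)) (v := y),
      T.dist_comm (u := v (pos y)) (v := v (pos x))] at h8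
    simp only [gap] at *
    omega
  · intro x y hxy
    have hx := hposD x
    have h1 := hdist x (pos x) (by omega)
    have h2 := hdist y (pos x) (by omega)
    have h3 := tri x (v (pos x)) y
    rw [T.dist_comm (u := v (pos x)) (v := y)] at h3
    simp only [gap] at *
    omega
  · intro x y hxy
    have hx := hposD x
    have h1 := hdist x (pos x) (by omega)
    have h2 := hdist y (pos x) (by omega)
    have h3 := tri x y (v (pos x))
    simp only [gap] at *
    omega
  · intro x y hxy
    have hx := hposD x
    have h1 := hdist x (pos x) (by omega)
    have h2 := hdist y (pos x) (by omega)
    have h3 := even_dist_add hT x y (v (pos x))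
    rw [h1, h2, ← hxy] at h3
    simpa [gap] using h3
  · intro x x' y hxy hxy' hht h1 h2
    have hx := hposD y
    have e1 := hdist x (pos y) (by omega)
    have e2 := hdist x' (pos y) (by omega)
    have e3 := hdist y (pos y) (by omega)
    have e4 := four_point hT x x' y (v (pos y))
    refine hc.dist_eq_zero_iff.1 ?_
    simp only [gap] at *
    omega

variable (σ : Spine T D)

/-- The eccentricity of a vertex, in terms of a diametral path. -/
def ecc (x : V) : ℕ := σ.ht x + max (σ.pos x) (D - σ.pos x)

theorem dist_of_ht_eq_zero (x : V) {y : V} (hy : σ.ht y = 0) :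
    T.dist x y = σ.ht x + gap (σ.pos x) (σ.pos y) := by
  by_cases h : σ.pos x = σ.pos y
  · have h1 := σ.dist_le x y h
    have h2 := σ.le_dist x y h
    simp only [gap]
    omega
  · rw [σ.dist_of_ne x y h, hy, add_zero]

theorem dist_v (x : V) {i : ℕ} (hi : i ≤ D) :
    T.dist x (σ.v i) = σ.ht x + gap (σ.pos x) i := by
  rw [σ.dist_of_ht_eq_zero x (σ.ht_v i hi), σ.pos_v i hi]

/-- An end of the path is always a farthest vertex, since a branch at position p has height at most
min (p, D - p). -/
theorem eccent_eq (hT : T.Connected) (x : V) : (T.eccent x).toNat = σ.ecc x := by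
  have hed : ∀ y, T.edist x y = (T.dist x y : ℕ∞) := fun y => (hT x y).coe_dist_eq_edist.symm
  have h : T.eccent x = (σ.ecc x : ℕ∞) := by
    refine le_antisymm ((eccent_le_iff x _).2 fun y => ?_) ?_
    · rw [hed, Nat.cast_le]
      have h1 := σ.ht_le y
      have h2 := σ.ht_add_le y
      by_cases h : σ.pos x = σ.pos y
      · have := σ.dist_le x y h
        simp only [ecc]
        omega
      · rw [σ.dist_of_ne x y h]
        simp only [ecc, gap]
        omega
    · have h0 := σ.dist_v x (Nat.zero_le D)
      have hD := σ.dist_v x (le_refl D)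
      have h1 := σ.ht_add_le x
      rcases le_total (σ.pos x) (D - σ.pos x) with h | h
      · have : σ.ecc x = T.dist x (σ.v D) := by rw [hD]; simp only [ecc, gap]; omega
        rw [this, ← hed]
        exact edist_le_eccent
      · have : σ.ecc x = T.dist x (σ.v 0) := by rw [h0]; simp only [ecc, gap]; omega
        rw [this, ← hed]
        exact edist_le_eccent
  rw [h, ENat.toNat_natCast]

/-- The reversed diametral path. -/
def reverse : Spine T D where
  v i := σ.v (D - i)
  pos x := D - σ.pos x
  ht := σ.ht
  pos_v i hi := by rw [σ.pos_v _ (by omega)]; omega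
  ht_v i hi := σ.ht_v _ (by omega)
  v_pos x hx := by
    have := σ.ht_add_le x
    rw [show D - (D - σ.pos x) = σ.pos x by omega, σ.v_pos x hx]
  ht_le x := by have := σ.ht_add_le x; omega
  ht_add_le x := by have := σ.ht_le x; have := σ.ht_add_le x; omega
  dist_of_ne x y h := by
    have := σ.ht_add_le x
    have := σ.ht_add_le y
    rw [σ.dist_of_ne x y (by omega)]
    simp only [gap]
    omega
  dist_le x y h := by
    have := σ.ht_add_le x
    have := σ.ht_add_le y
    exact σ.dist_le x y (by omega)
  le_dist x y h := by
    have := σ.ht_add_le x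
    have := σ.ht_add_le y
    exact σ.le_dist x y (by omega)
  even_dist x y h := by
    have := σ.ht_add_le x
    have := σ.ht_add_le y
    exact σ.even_dist x y (by omega)
  eq_of_dist x x' y h h' := by
    have := σ.ht_add_le x
    have := σ.ht_add_le x'
    have := σ.ht_add_le y
    exact σ.eq_of_dist x x' y (by omega) (by omega)

theorem reverse_ecc (x : V) : σ.reverse.ecc x = σ.ecc x := by
  have := σ.ht_add_le x
  simp only [ecc, reverse]
  omega

/-- All vertices off the path are pendant vertices attached to its first half. -/
def Good : Prop := ∀ x, σ.ht x ≠ 0 → σ.ht x = 1 ∧ 2 * σ.pos x ≤ D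

/-- The data of a vertex preserved when two trees are compared. -/
def key (x : V) : ℕ ⊕ ℕ := if σ.ht x = 0 then .inl (σ.pos x) else .inr (σ.ecc x)

variable [Fintype V]

theorem sum_path {M : Type*} [AddCommMonoid M] (g : V → M) :
    ∑ x with σ.ht x = 0, g x = ∑ i ∈ Finset.range (D + 1), g (σ.v i) := by
  refine Finset.sum_bij' (fun x _ => σ.pos x) (fun i _ => σ.v i) ?_ ?_ ?_ ?_ ?_
  · intro x _
    have := σ.ht_add_le x
    rw [Finset.mem_range]
    omega
  · intro i hi
    rw [Finset.mem_range] at hi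
    simpa using σ.ht_v i (by omega)
  · intro x hx
    exact σ.v_pos x (by simpa using hx)
  · intro i hi
    rw [Finset.mem_range] at hi
    exact σ.pos_v i (by omega)
  · intro x hx
    rw [σ.v_pos x (by simpa using hx)]

omit [Fintype V] in
theorem ecc_v {i : ℕ} (hi : i ≤ D) : σ.ecc (σ.v i) = max i (D - i) := by
  rw [ecc, σ.ht_v i hi, σ.pos_v i hi, zero_add]

/-- The path term depends on D alone, so the eccentricity counts of the whole tree determine those
off the path. -/
theorem card_ecc_eq (e : ℕ) :
    Finset.card {x | σ.ecc x = e} =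
      Finset.card ((Finset.range (D + 1)).filter fun i => max i (D - i) = e) +
      Finset.card {x | σ.ht x ≠ 0 ∧ σ.ecc x = e} := by
  rw [← Finset.card_filter_add_card_filter_not (s := Finset.univ.filter fun x => σ.ecc x = e)
    (fun x => σ.ht x = 0), Finset.filter_filter, Finset.filter_filter]
  congr 1
  · have h := σ.sum_path (fun x => if σ.ecc x = e then 1 else 0)
    rw [← Finset.sum_filter, Finset.filter_filter, Finset.sum_const, smul_eq_mul, mul_one] at h
    simp only [and_comm] at h ⊢
    rw [h, Finset.card_filter]
    refine Finset.sum_congr rfl fun i hi => ?_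
    rw [Finset.mem_range] at hi
    rw [σ.ecc_v (by omega)]
  · congr 1
    ext x
    simp [and_comm]

theorem card_key_inl (i : ℕ) :
    Finset.card {x | σ.key x = .inl i} = if i ≤ D then 1 else 0 := by
  split_ifs with h
  · rw [Finset.card_eq_one]
    refine ⟨σ.v i, ?_⟩
    ext x
    simp only [Finset.mem_filter, Finset.mem_univ, true_and, Finset.mem_singleton]
    unfold key
    constructor
    · intro hx
      split_ifs at hx with h0
      rw [← Sum.inl_injective hx, σ.v_pos x h0]
    · rintro rfl
      rw [if_pos (σ.ht_v i h), σ.pos_v i h]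
  · rw [Finset.card_eq_zero, Finset.filter_eq_empty_iff]
    intro x _ hx
    have := σ.ht_add_le x
    unfold key at hx
    split_ifs at hx with h0
    have := Sum.inl_injective hx
    omega

theorem card_key_inr (e : ℕ) :
    Finset.card {x | σ.key x = .inr e} = Finset.card {x | σ.ht x ≠ 0 ∧ σ.ecc x = e} := by
  congr 1
  ext x
  simp only [Finset.mem_filter, Finset.mem_univ, true_and]
  unfold key
  by_cases h : σ.ht x = 0 <;> simp [h]

theorem exists_equiv {V' : Type*} [Fintype V'] {T' : SimpleGraph V'} (σ' : Spine T' D)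
    (h : ∀ e, Finset.card {x | σ.ecc x = e} = Finset.card {x | σ'.ecc x = e}) :
    ∃ φ : V ≃ V', ∀ x, σ'.key (φ x) = σ.key x := by
  have hcard : ∀ c, Finset.card {x | σ.key x = c} = Finset.card {x | σ'.key x = c} := by
    rintro (i | e)
    · rw [card_key_inl, card_key_inl]
    · have := h e
      rw [card_ecc_eq, card_ecc_eq] at this
      rw [card_key_inr, card_key_inr]
      omega
  have hne : ∀ c, Nonempty ({x // σ.key x = c} ≃ {x // σ'.key x = c}) := by
    intro c
    rw [← Fintype.card_eq, Fintype.card_subtype, Fintype.card_subtype]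
    exact hcard c
  exact ⟨Equiv.ofFiberEquiv fun c => (hne c).some, Equiv.ofFiberEquiv_map _⟩

end Spine

/-! ### Distance sums along the path. -/

theorem two_mul_sum_gap (p q : ℕ) :
    2 * ∑ i ∈ Finset.range (p + q + 1), gap p i = p * (p + 1) + q * (q + 1) := by
  induction q with
  | zero =>
    have h := Finset.sum_range_reflect (fun i => i) (p + 1)
    have h2 := Finset.sum_range_id_mul_two (p + 1)
    have h3 : ∑ i ∈ Finset.range (p + 0 + 1), gap p i =
        ∑ i ∈ Finset.range (p + 1), (p + 1 - 1 - i) := by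
      refine Finset.sum_congr rfl fun i hi => ?_
      rw [Finset.mem_range] at hi
      simp only [gap]
      omega
    rw [h3, h, mul_comm, h2]
    simp [mul_comm]
  | succ q ih =>
    rw [← add_assoc, Finset.sum_range_succ, mul_add, ih]
    have : gap p (p + q + 1) = q + 1 := by simp only [gap]; omega
    rw [this]
    ring

/-- Moving from position P + k to P raises the sum by k (D - k - 2P), while lowering the height by k
saves (D + 1) k. The net saving k (2P + k + 1) is at least 4k once P and k are positive. -/
theorem sum_gap_le_of_two_mul_le {P k D : ℕ} (hP : 1 ≤ P) (h : 2 * (P + k) ≤ D) :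
    ∑ i ∈ Finset.range (D + 1), gap P i + 4 * k ≤
      ∑ i ∈ Finset.range (D + 1), gap (P + k) i + (D + 1) * k := by
  obtain ⟨q, rfl⟩ : ∃ q, D = P + k + q := ⟨D - (P + k), by omega⟩
  have h1 := two_mul_sum_gap P (k + q)
  have h2 := two_mul_sum_gap (P + k) q
  rw [← add_assoc] at h1
  rcases Nat.eq_zero_or_pos k with rfl | hk
  · simp
  · nlinarith [mul_le_mul hk hP (Nat.zero_le _) (Nat.zero_le _), Nat.mul_le_mul_left k hP,
      Nat.mul_le_mul_left k hk]

theorem sum_gap_reflect {p D : ℕ} (hp : p ≤ D) :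
    ∑ i ∈ Finset.range (D + 1), gap (D - p) i = ∑ i ∈ Finset.range (D + 1), gap p i := by
  rw [← Finset.sum_range_reflect]
  refine Finset.sum_congr rfl fun i hi => ?_
  rw [Finset.mem_range] at hi
  simp only [gap]
  omega

/-! ### Comparison of a tree with a good caterpillar. -/

namespace Spine

variable {V V' : Type*} {T : SimpleGraph V} {T' : SimpleGraph V'} {D : ℕ} (σ : Spine T D)
  (σ' : Spine T' D)

theorem key_eq_iff {x : V} {y : V'} : σ'.key y = σ.key x ↔
    (σ'.ht y = 0 ∧ σ.ht x = 0 ∧ σ'.pos y = σ.pos x) ∨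
      (σ'.ht y ≠ 0 ∧ σ.ht x ≠ 0 ∧ σ'.ecc y = σ.ecc x) := by
  unfold key
  split_ifs <;> simp_all

/-- On a good spine the eccentricity of an off-path vertex determines its position, so keys
determine all distances. -/
theorem Good.ecc_add_pos {σ : Spine T D} (hσ : σ.Good) {x : V} (hx : σ.ht x ≠ 0) :
    σ.ecc x + σ.pos x = D + 1 := by
  have := hσ x hx
  simp only [ecc]
  omega

theorem Good.dist_le {σ : Spine T D} (hσ : σ.Good) {x y : V} (hx : σ.ht x ≠ 0)
    (hy : σ.ht y ≠ 0) : T.dist x y ≤ 2 + gap (σ.ecc x) (σ.ecc y) := by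
  have h1 := hσ.ecc_add_pos hx
  have h2 := hσ.ecc_add_pos hy
  have h3 := hσ x hx
  have h4 := hσ y hy
  by_cases h : σ.pos x = σ.pos y
  · have := σ.dist_le x y h
    omega
  · rw [σ.dist_of_ne x y h]
    simp only [gap]
    omega

theorem Good.dist_eq (hT : T.Connected) {σ : Spine T D} (hσ : σ.Good) {x y : V} (hxy : x ≠ y) :
    T.dist x y = σ.ht x + σ.ht y + gap (σ.pos x) (σ.pos y) := by
  by_cases hp : σ.pos x = σ.pos y
  · by_cases hy : σ.ht y = 0
    · rw [σ.dist_of_ht_eq_zero x hy, hy, add_zero]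
    · by_cases hx : σ.ht x = 0
      · rw [T.dist_comm, σ.dist_of_ht_eq_zero y hx, hx, hp]
        simp [gap]
      · have h1 := hσ x hx
        have h2 := hσ y hy
        have h3 := σ.dist_le x y hp
        have h4 := hT.pos_dist_of_ne hxy
        obtain ⟨k, hk⟩ := σ.even_dist x y hp
        simp only [gap]
        omega
  · exact σ.dist_of_ne x y hp

theorem dist_eq_dist_of_good (hT : T.Connected) (hT' : T'.Connected) {σ : Spine T D}
    {σ' : Spine T' D} (hσ : σ.Good) (hσ' : σ'.Good) (φ : V ≃ V')
    (hφ : ∀ x, σ'.key (φ x) = σ.key x) (x y : V) : T'.dist (φ x) (φ y) = T.dist x y := by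
  by_cases hxy : x = y
  · simp [hxy]
  · have hkey : ∀ x, σ'.ht (φ x) = σ.ht x ∧ σ'.pos (φ x) = σ.pos x := by
      intro x
      rcases (σ.key_eq_iff σ').1 (hφ x) with ⟨h1, h2, h3⟩ | ⟨h1, h2, h3⟩
      · exact ⟨h1.trans h2.symm, h3⟩
      · have := hσ.ecc_add_pos h2
        have := hσ'.ecc_add_pos h1
        have := hσ _ h2
        have := hσ' _ h1
        omega
    rw [hσ.dist_eq hT hxy, hσ'.dist_eq hT' (φ.injective.ne hxy), (hkey x).1, (hkey x).2,
      (hkey y).1, (hkey y).2]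

theorem nonempty_iso_of_good (hT : T.Connected) (hT' : T'.Connected) {σ : Spine T D}
    {σ' : Spine T' D} (hσ : σ.Good) (hσ' : σ'.Good) (φ : V ≃ V')
    (hφ : ∀ x, σ'.key (φ x) = σ.key x) : Nonempty (T ≃g T') :=
  ⟨⟨φ, by
    intro x y
    rw [← dist_eq_one_iff_adj, ← dist_eq_one_iff_adj,
      dist_eq_dist_of_good hT hT' hσ hσ' φ hφ]⟩⟩

/-- `x` lies off the path and strictly between `y` and the path. -/
def Below (x y : V) : Prop :=
  σ.ht x ≠ 0 ∧ x ≠ y ∧ σ.pos x = σ.pos y ∧ T.dist x y + σ.ht x = σ.ht y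

open Classical in
-- At a common position the distance has the parity of the height difference and is at least as
-- large. It equals the difference exactly when one vertex is below the other, and otherwise exceeds
-- it by 2 or more. At different positions, both heights being positive gives the bound directly.
theorem two_add_gap_le {x y : V} (hx : σ.ht x ≠ 0) (hy : σ.ht y ≠ 0)
    (hxy : x ≠ y) : 2 + gap (σ.ecc x) (σ.ecc y) ≤
      T.dist x y + 2 * (if σ.Below x y then 1 else 0) + 2 * (if σ.Below y x then 1 else 0) := by
  have hx1 := σ.ht_add_le x
  have hy1 := σ.ht_add_le y
  by_cases hp : σ.pos x = σ.pos y
  · have h1 := σ.le_dist x y hp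
    have h2 := σ.le_dist y x hp.symm
    rw [T.dist_comm (u := y)] at h2
    obtain ⟨k, hk⟩ := σ.even_dist x y hp
    have h3 : gap (σ.ecc x) (σ.ecc y) = gap (σ.ht x) (σ.ht y) := by
      simp only [gap, ecc, hp]
      omega
    rw [h3]
    by_cases hb : σ.Below x y
    · rw [if_pos hb]
      have := hb.2.2.2
      simp only [gap]
      omega
    · by_cases hb' : σ.Below y x
      · rw [if_pos hb']
        have := hb'.2.2.2
        rw [T.dist_comm (u := y)] at this
        simp only [gap]
        omega
      · have e1 : T.dist x y + σ.ht x ≠ σ.ht y := fun h => hb ⟨hx, hxy, hp, h⟩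
        have e2 : T.dist x y + σ.ht y ≠ σ.ht x := fun h =>
          hb' ⟨hy, hxy.symm, hp.symm, by rwa [T.dist_comm]⟩
        simp only [gap]
        omega
  · rw [σ.dist_of_ne x y hp]
    simp only [gap, ecc]
    omega

variable [Fintype V]

open Classical in
-- The vertices below y lie on its geodesic to the path, so they have distinct heights between 1 and
-- ht y - 1.
theorem card_below_le (hT : T.Connected) (y : V) :
    Finset.card {x | σ.Below x y} ≤ σ.ht y - 1 := by
  rw [← Nat.card_Ico 1 (σ.ht y)]
  refine Finset.card_le_card_of_injOn σ.ht ?_ ?_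
  · intro x hx
    have hx : σ.Below x y := by simpa using hx
    have := hT.pos_dist_of_ne hx.2.1
    have := hx.2.2.2
    have := hx.1
    simp only [Finset.coe_Ico, Set.mem_Ico]
    omega
  · intro x hx x' hx' h
    have hx : σ.Below x y := by simpa using hx
    have hx' : σ.Below x' y := by simpa using hx'
    exact σ.eq_of_dist x x' y hx.2.2.1 hx'.2.2.1 h hx.2.2.2 hx'.2.2.2

section Compare

variable {σ σ'} (hσ' : σ'.Good) (φ : V ≃ V') (hφ : ∀ x, σ'.key (φ x) = σ.key x)

include hσ' hφ

theorem sum_path_add_le {x : V} (hx : σ.ht x ≠ 0) :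
    ∑ y with σ.ht y = 0, T'.dist (φ x) (φ y) + 4 * (σ.ht x - 1) ≤
      ∑ y with σ.ht y = 0, T.dist x y := by
  rcases (σ.key_eq_iff σ').1 (hφ x) with ⟨-, h2, -⟩ | ⟨h1, -, h3⟩
  · exact absurd h2 hx
  have hg := hσ' _ h1
  have he := hσ'.ecc_add_pos h1
  rw [σ.sum_path, σ.sum_path]
  have hl : ∑ i ∈ Finset.range (D + 1), T'.dist (φ x) (φ (σ.v i)) =
      (D + 1) + ∑ i ∈ Finset.range (D + 1), gap (σ'.pos (φ x)) i := by
    trans ∑ i ∈ Finset.range (D + 1), (1 + gap (σ'.pos (φ x)) i)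
    · refine Finset.sum_congr rfl fun i hi => ?_
      rw [Finset.mem_range] at hi
      have hv := σ.ht_v i (by omega)
      rcases (σ.key_eq_iff σ').1 (hφ (σ.v i)) with ⟨h4, -, h5⟩ | ⟨-, h4, -⟩
      · rw [σ'.dist_of_ht_eq_zero _ h4, h5, σ.pos_v i (by omega), hg.1]
      · exact absurd hv h4
    · simp [Finset.sum_add_distrib]
  have hr : ∑ i ∈ Finset.range (D + 1), T.dist x (σ.v i) =
      (D + 1) * σ.ht x + ∑ i ∈ Finset.range (D + 1), gap (σ.pos x) i := by
    trans ∑ i ∈ Finset.range (D + 1), (σ.ht x + gap (σ.pos x) i)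
    · refine Finset.sum_congr rfl fun i hi => ?_
      rw [Finset.mem_range] at hi
      rw [σ.dist_v x (by omega)]
    · simp [Finset.sum_add_distrib]
  rw [hl, hr]
  have hle := σ.ht_le x
  have hle' := σ.ht_add_le x
  obtain ⟨k, hk⟩ : ∃ k, σ.ht x = k + 1 := ⟨σ.ht x - 1, by omega⟩
  rw [h3, ecc] at he
  rw [hk, Nat.add_sub_cancel, mul_add, mul_one]
  -- Equality of eccentricities places the image exactly k steps nearer to the end closest to x; the
  -- second half is reduced to the first by reflection.
  rcases le_total (2 * σ.pos x) D with hD | hD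
  · have hpos : σ.pos x = σ'.pos (φ x) + k := by omega
    have := sum_gap_le_of_two_mul_le (P := σ'.pos (φ x)) (k := k) (D := D) (by omega) (by omega)
    rw [← hpos] at this
    omega
  · have hpos : D - σ.pos x = σ'.pos (φ x) + k := by omega
    have := sum_gap_le_of_two_mul_le (P := σ'.pos (φ x)) (k := k) (D := D) (by omega) (by omega)
    rw [← hpos, sum_gap_reflect (by omega)] at this
    omega

omit [Fintype V] hσ' in
theorem dist_path_path {x y : V} (hx : σ.ht x = 0) (hy : σ.ht y = 0) :
    T'.dist (φ x) (φ y) = T.dist x y := by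
  rcases (σ.key_eq_iff σ').1 (hφ x) with ⟨h1, -, h2⟩ | ⟨-, h1, -⟩
  · rcases (σ.key_eq_iff σ').1 (hφ y) with ⟨h3, -, h4⟩ | ⟨-, h3, -⟩
    · rw [σ.dist_of_ht_eq_zero x hy, σ'.dist_of_ht_eq_zero _ h3, h2, h4, hx, h1]
    · exact absurd hy h3
  · exact absurd hx h1

omit [Fintype V] in
open Classical in
theorem dist_image_le {x y : V} (hx : σ.ht x ≠ 0) (hy : σ.ht y ≠ 0) :
    T'.dist (φ x) (φ y) ≤
      T.dist x y + 2 * (if σ.Below x y then 1 else 0) + 2 * (if σ.Below y x then 1 else 0) := by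
  by_cases hxy : x = y
  · simp [hxy]
  · refine le_trans ?_ (σ.two_add_gap_le hx hy hxy)
    rcases (σ.key_eq_iff σ').1 (hφ x) with ⟨-, h1, -⟩ | ⟨h1, -, h2⟩
    · exact absurd h1 hx
    rcases (σ.key_eq_iff σ').1 (hφ y) with ⟨-, h3, -⟩ | ⟨h3, -, h4⟩
    · exact absurd h3 hy
    rw [← h2, ← h4]
    exact hσ'.dist_le h1 h3

end Compare

theorem totalDist_split (f : V → V → ℕ) (hf : ∀ x y, f x y = f y x) :
    ∑ x, ∑ y, f x y = ∑ x with σ.ht x = 0, ∑ y with σ.ht y = 0, f x y +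
      2 * ∑ x with σ.ht x ≠ 0, ∑ y with σ.ht y = 0, f x y +
      ∑ x with σ.ht x ≠ 0, ∑ y with σ.ht y ≠ 0, f x y := by
  have h : ∀ g : V → ℕ, ∑ x, g x = ∑ x with σ.ht x = 0, g x + ∑ x with σ.ht x ≠ 0, g x :=
    fun g => (Finset.sum_filter_add_sum_filter_not _ _ _).symm
  rw [h]
  simp only [fun x => h (f x), Finset.sum_add_distrib]
  rw [Finset.sum_comm (s := Finset.univ.filter fun x => σ.ht x = 0)
    (t := Finset.univ.filter fun x => σ.ht x ≠ 0)]
  simp only [hf]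
  rw [two_mul]
  simp only [add_assoc]

variable [Fintype V']

theorem totalDist_image (φ : V ≃ V') : totalDist T' = ∑ x, ∑ y, T'.dist (φ x) (φ y) := by
  rw [totalDist, ← φ.sum_comp]
  exact Finset.sum_congr rfl fun x _ => (φ.sum_comp _).symm

variable {σ σ'}

theorem totalDist_add_le (hT : T.Connected) (hσ' : σ'.Good) (φ : V ≃ V')
    (hφ : ∀ x, σ'.key (φ x) = σ.key x) :
    totalDist T' + 4 * ∑ x with σ.ht x ≠ 0, (σ.ht x - 1) ≤ totalDist T := by
  classical
  rw [totalDist_image φ, totalDist, σ.totalDist_split _ fun _ _ => T'.dist_comm,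
    σ.totalDist_split _ fun _ _ => T.dist_comm]
  have h1 : ∑ x with σ.ht x = 0, ∑ y with σ.ht y = 0, T'.dist (φ x) (φ y) =
      ∑ x with σ.ht x = 0, ∑ y with σ.ht y = 0, T.dist x y := by
    refine Finset.sum_congr rfl fun x hx => Finset.sum_congr rfl fun y hy => ?_
    exact dist_path_path φ hφ (by simpa using hx) (by simpa using hy)
  have h2 : ∑ x with σ.ht x ≠ 0, ∑ y with σ.ht y = 0, T'.dist (φ x) (φ y) +
      4 * ∑ x with σ.ht x ≠ 0, (σ.ht x - 1) ≤
      ∑ x with σ.ht x ≠ 0, ∑ y with σ.ht y = 0, T.dist x y := by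
    rw [Finset.mul_sum, ← Finset.sum_add_distrib]
    exact Finset.sum_le_sum fun x hx => sum_path_add_le hσ' φ hφ (by simpa using hx)
  have hb : ∑ x with σ.ht x ≠ 0, ∑ y with σ.ht y ≠ 0, (if σ.Below y x then 1 else 0) ≤
      ∑ x with σ.ht x ≠ 0, (σ.ht x - 1) := by
    refine Finset.sum_le_sum fun x _ => ?_
    rw [← Finset.card_filter]
    exact (Finset.card_le_card (Finset.filter_subset_filter _ (Finset.subset_univ _))).trans
      (σ.card_below_le hT x)
  have hb' : ∑ x with σ.ht x ≠ 0, ∑ y with σ.ht y ≠ 0, (if σ.Below x y then 1 else 0) ≤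
      ∑ x with σ.ht x ≠ 0, (σ.ht x - 1) := by
    rwa [Finset.sum_comm]
  have h3 : ∑ x with σ.ht x ≠ 0, ∑ y with σ.ht y ≠ 0, T'.dist (φ x) (φ y) ≤
      ∑ x with σ.ht x ≠ 0, ∑ y with σ.ht y ≠ 0, T.dist x y +
      2 * ∑ x with σ.ht x ≠ 0, ∑ y with σ.ht y ≠ 0, (if σ.Below x y then 1 else 0) +
      2 * ∑ x with σ.ht x ≠ 0, ∑ y with σ.ht y ≠ 0, (if σ.Below y x then 1 else 0) := by
    simp only [Finset.mul_sum, ← Finset.sum_add_distrib]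
    exact Finset.sum_le_sum fun x hx => Finset.sum_le_sum fun y hy =>
      dist_image_le hσ' φ hφ (by simpa using hx) (by simpa using hy)
  omega

theorem ht_eq_one_of_totalDist_eq (hT : T.Connected) (hσ' : σ'.Good) (φ : V ≃ V')
    (hφ : ∀ x, σ'.key (φ x) = σ.key x) (h : totalDist T = totalDist T') {x : V}
    (hx : σ.ht x ≠ 0) : σ.ht x = 1 := by
  have h1 := totalDist_add_le hT hσ' φ hφ
  have h2 : ∑ x with σ.ht x ≠ 0, (σ.ht x - 1) = 0 := by omega
  have := Finset.sum_eq_zero_iff.1 h2 x (by simpa using hx)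
  omega

/-- With all heights 1, pendant vertices at p < D/2 < p' are at distance 2 + p' - p. Their images
are at distance at most 2 + |D - p - p'|, which is strictly smaller, while no other pair gives
anything back. -/
theorem not_both_sides_of_totalDist_eq (hT : T.Connected) (hσ' : σ'.Good) (φ : V ≃ V')
    (hφ : ∀ x, σ'.key (φ x) = σ.key x) (h : totalDist T = totalDist T') {x y : V}
    (hx : σ.ht x ≠ 0) (hy : σ.ht y ≠ 0) (hxD : 2 * σ.pos x < D) : 2 * σ.pos y ≤ D := by
  classical
  by_contra hyD
  have hone := fun {x} => ht_eq_one_of_totalDist_eq (x := x) hT hσ' φ hφ h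
  have hb : ∀ x y, σ.ht y ≠ 0 → ¬ σ.Below x y := by
    intro x y hy hxy
    have h1 := hone hxy.1
    have h2 := hone hy
    have h3 := hxy.2.2.2
    have h4 := hT.pos_dist_of_ne hxy.2.1
    omega
  have hle : ∀ x y, σ.ht x ≠ 0 → σ.ht y ≠ 0 → T'.dist (φ x) (φ y) ≤ T.dist x y := by
    intro x y hx hy
    have := dist_image_le hσ' φ hφ hx hy
    simpa [hb x y hy, hb y x hx] using this
  have hlt : T'.dist (φ x) (φ y) < T.dist x y := by
    rcases (σ.key_eq_iff σ').1 (hφ x) with ⟨-, h1, -⟩ | ⟨h1, -, h2⟩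
    · exact absurd h1 hx
    rcases (σ.key_eq_iff σ').1 (hφ y) with ⟨-, h3, -⟩ | ⟨h3, -, h4⟩
    · exact absurd h3 hy
    have h5 := hσ'.dist_le h1 h3
    have h6 := hone hx
    have h7 := hone hy
    have h8 := σ.ht_add_le y
    rw [h2, h4] at h5
    rw [σ.dist_of_ne x y (by omega)]
    simp only [ecc, gap] at h5 ⊢
    omega
  rw [totalDist_image (T' := T') φ, totalDist, σ.totalDist_split _ fun _ _ => T'.dist_comm,
    σ.totalDist_split _ fun _ _ => T.dist_comm] at h
  have h1 : ∑ x with σ.ht x = 0, ∑ y with σ.ht y = 0, T'.dist (φ x) (φ y) =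
      ∑ x with σ.ht x = 0, ∑ y with σ.ht y = 0, T.dist x y := by
    refine Finset.sum_congr rfl fun x hx => Finset.sum_congr rfl fun y hy => ?_
    exact dist_path_path φ hφ (by simpa using hx) (by simpa using hy)
  have h2 : ∑ x with σ.ht x ≠ 0, ∑ y with σ.ht y = 0, T'.dist (φ x) (φ y) ≤
      ∑ x with σ.ht x ≠ 0, ∑ y with σ.ht y = 0, T.dist x y :=
    Finset.sum_le_sum fun x hx =>
      (Nat.le_add_right _ _).trans (sum_path_add_le hσ' φ hφ (by simpa using hx))
  have h3 : ∑ x with σ.ht x ≠ 0, ∑ y with σ.ht y ≠ 0, T'.dist (φ x) (φ y) <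
      ∑ x with σ.ht x ≠ 0, ∑ y with σ.ht y ≠ 0, T.dist x y := by
    refine Finset.sum_lt_sum (fun x hx => Finset.sum_le_sum fun y hy =>
      hle x y (by simpa using hx) (by simpa using hy)) ⟨x, by simpa using hx, ?_⟩
    exact Finset.sum_lt_sum (fun y hy => hle x y hx (by simpa using hy))
      ⟨y, by simpa using hy, hlt⟩
  omega

theorem totalDist_le_and_iso (hT : T.Connected) (hT' : T'.Connected) (σ : Spine T D)
    {σ' : Spine T' D} (hσ' : σ'.Good)
    (h : ∀ e, Finset.card {x | σ.ecc x = e} = Finset.card {x | σ'.ecc x = e}) :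
    totalDist T' ≤ totalDist T ∧ (totalDist T = totalDist T' → Nonempty (T ≃g T')) := by
  obtain ⟨φ, hφ⟩ := σ.exists_equiv σ' h
  refine ⟨le_of_add_le_left (totalDist_add_le hT hσ' φ hφ), fun heq => ?_⟩
  have hone := fun {x} => ht_eq_one_of_totalDist_eq (x := x) hT hσ' φ hφ heq
  by_cases hgood : ∃ x, σ.ht x ≠ 0 ∧ 2 * σ.pos x < D
  · obtain ⟨x, hx, hxD⟩ := hgood
    have hσ : σ.Good := fun y hy =>
      ⟨hone hy, not_both_sides_of_totalDist_eq hT hσ' φ hφ heq hx hy hxD⟩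
    exact nonempty_iso_of_good hT hT' hσ hσ' φ hφ
  · push Not at hgood
    have hσ : σ.reverse.Good := fun y hy => ⟨hone hy, by
      have := hgood y hy
      simp only [reverse]
      omega⟩
    -- Reversal changes path positions, hence keys, so a new bijection is needed; the eccentricities
    -- are unaffected.
    obtain ⟨ψ, hψ⟩ := σ.reverse.exists_equiv σ' (by simpa only [reverse_ecc] using h)
    exact nonempty_iso_of_good hT hT' hσ hσ' ψ hψ

end Spine

/-! ### The caterpillar: metric, tree property and spine. -/

namespace CatVertex

variable {q : ℕ} {t : ℕ → ℕ}

/-- The position on the path at which a vertex of a caterpillar hangs. -/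
def pos (x : CatVertex q t) : ℕ := x.elim (fun i => i.val) fun p => p.1.val + 1

/-- The distance of a vertex of a caterpillar from the path. -/
def ht (x : CatVertex q t) : ℕ := x.elim (fun _ => 0) fun _ => 1

theorem pos_le (x : CatVertex q t) : ht x + pos x ≤ q + 1 := by
  rcases x with i | p
  · have := i.2
    simp only [ht, pos, Sum.elim_inl]
    omega
  · have := p.1.2
    simp only [ht, pos, Sum.elim_inr]
    omega

theorem eq_of_ht_eq_zero {x y : CatVertex q t} (hx : ht x = 0) (hy : ht y = 0)
    (h : pos x = pos y) : x = y := by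
  rcases x with i | p
  · rcases y with k | p
    · exact congrArg Sum.inl (Fin.ext h)
    · simp [ht] at hy
  · simp [ht] at hx

/-- The path vertex at which a vertex of a caterpillar hangs. -/
def base (x : CatVertex q t) : CatVertex q t := .inl ⟨pos x, by have := pos_le x; omega⟩

@[simp] theorem pos_base (x : CatVertex q t) : pos (base x) = pos x := rfl

@[simp] theorem ht_base (x : CatVertex q t) : ht (base x) = 0 := rfl

theorem base_eq {x : CatVertex q t} (hx : ht x = 0) : base x = x :=
  eq_of_ht_eq_zero rfl hx rfl

end CatVertex

open CatVertex

variable {q : ℕ} {t : ℕ → ℕ}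

theorem catTree_adj {x y : CatVertex q t} :
    (catTree q t).Adj x y ↔ ht x + ht y + gap (pos x) (pos y) = 1 := by
  rw [catTree, fromRel_adj]
  rcases x with i | p <;> rcases y with k | p' <;> simp [ht, pos, gap, Fin.ext_iff] <;> omega

theorem exists_catTree_walk (n : ℕ) {x y : CatVertex q t} (hx : ht x = 0) (hy : ht y = 0)
    (h : pos y = pos x + n) : ∃ p : (catTree q t).Walk x y, p.length = n := by
  induction n generalizing y with
  | zero =>
    obtain rfl := eq_of_ht_eq_zero hx hy h.symm
    exact ⟨.nil, rfl⟩
  | succ n ih =>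
    have hle := pos_le y
    obtain ⟨p, hp⟩ := ih (y := .inl ⟨pos x + n, by omega⟩) rfl rfl
    refine ⟨p.concat (catTree_adj.2 ?_), by simp [hp]⟩
    rw [hy, h]
    simp only [ht, pos, gap, Sum.elim_inl]
    omega

theorem catTree_connected (q : ℕ) (t : ℕ → ℕ) : (catTree q t).Connected := by
  rw [connected_iff_exists_forall_reachable]
  refine ⟨.inl 0, fun x => ?_⟩
  obtain ⟨p, -⟩ := exists_catTree_walk (pos x) (x := .inl (0 : Fin (q + 2))) (y := base x) rfl rfl
    (Nat.zero_add _).symm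
  refine p.reachable.trans ?_
  by_cases hx : ht x = 0
  · rw [base_eq hx]
  · refine (catTree_adj.2 ?_).reachable
    rcases x with i | x
    · exact absurd rfl hx
    · rw [ht_base, pos_base]
      simp [ht, gap]

theorem catTree_dist {x y : CatVertex q t} (hxy : x ≠ y) :
    (catTree q t).dist x y = ht x + ht y + gap (pos x) (pos y) := by
  have hc := catTree_connected q t
  refine le_antisymm ?_ ?_
  · have hb : ∀ z : CatVertex q t, (catTree q t).dist z (base z) ≤ ht z := by
      intro z
      by_cases hz : ht z = 0
      · simp [base_eq hz]
      · rw [dist_eq_one_iff_adj.2 (catTree_adj.2 ?_)]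
        · omega
        · rcases z with i | z
          · exact absurd rfl hz
          · rw [ht_base, pos_base]
            simp [ht, gap]
    have hd : (catTree q t).dist (base x) (base y) ≤ gap (pos x) (pos y) := by
      rcases le_total (pos x) (pos y) with h | h
      · obtain ⟨p, hp⟩ := exists_catTree_walk (pos y - pos x) (ht_base x) (ht_base y)
          (by simp only [pos_base]; omega)
        have := dist_le p
        simp only [gap]
        omega
      · obtain ⟨p, hp⟩ := exists_catTree_walk (pos x - pos y) (ht_base y) (ht_base x)
          (by simp only [pos_base]; omega)
        have := dist_le p
        rw [SimpleGraph.dist_comm]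
        simp only [gap]
        omega
    have h1 : (catTree q t).dist x y ≤
        (catTree q t).dist x (base x) + (catTree q t).dist (base x) y := hc.dist_triangle
    have h2 : (catTree q t).dist (base x) y ≤
        (catTree q t).dist (base x) (base y) + (catTree q t).dist (base y) y := hc.dist_triangle
    rw [(catTree q t).dist_comm (u := base y)] at h2
    have := hb x
    have := hb y
    omega
  -- The claimed formula obeys the triangle inequality and equals 1 on edges, so it bounds walk
  -- lengths from below.
  · have key : ∀ a b : CatVertex q t, ∀ p : (catTree q t).Walk a b, a ≠ b →
        ht a + ht b + gap (pos a) (pos b) ≤ p.length := by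
      intro a b p
      induction p with
      | nil => exact fun h => absurd rfl h
      | @cons a c b h p ih =>
        intro _
        have h1 := catTree_adj.1 h
        rw [Walk.length_cons]
        by_cases hcb : c = b
        · subst hcb
          omega
        · have := ih hcb
          simp only [gap] at *
          omega
    obtain ⟨p, hp⟩ := hc.exists_walk_length_eq_dist x y
    rw [← hp]
    exact key x y p hxy

theorem catTree_isTree (q : ℕ) (t : ℕ → ℕ) : (catTree q t).IsTree := by
  classical
  have hc := catTree_connected q t
  rw [isTree_iff_connected_and_card]
  refine ⟨hc, le_antisymm ?_ hc.card_vert_le_card_edgeSet_add_one⟩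
  -- The neighbour towards v₀: the attachment vertex of a pendant vertex, the predecessor of a path
  -- vertex. Every edge joins a vertex other than v₀ to its parent, which bounds the number of
  -- edges.
  let par : CatVertex q t → CatVertex q t := fun x =>
    .inl ⟨pos x + ht x - 1, by have := pos_le x; omega⟩
  have hsub : (catTree q t).edgeFinset ⊆
      (Finset.univ.erase (.inl 0)).image fun x => s(x, par x) := by
    intro e he
    induction e with
    | _ a b =>
      have hab : (catTree q t).Adj a b := mem_edgeFinset.1 he
      have h1 := catTree_adj.1 hab
      have hpar : ∀ a b : CatVertex q t, ht b = 0 → pos b + 1 = pos a + ht a →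
          s(a, b) ∈ (Finset.univ.erase (.inl 0)).image fun x => s(x, par x) := by
        intro a b hb h
        refine Finset.mem_image.2 ⟨a, ?_, ?_⟩
        · rw [Finset.mem_erase]
          refine ⟨?_, Finset.mem_univ _⟩
          rintro rfl
          simp [pos, ht] at h
        · rw [eq_of_ht_eq_zero (x := par a) (y := b) rfl hb ?_]
          simp only [par, pos, Sum.elim_inl] at h ⊢
          omega
      by_cases h : ht b = 0 ∧ pos b + 1 = pos a + ht a
      · exact hpar a b h.1 h.2
      · rw [Sym2.eq_swap]
        refine hpar b a ?_ ?_ <;> simp only [gap] at h1 <;> omega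
  have h1 := (Finset.card_le_card hsub).trans Finset.card_image_le
  rw [Finset.card_erase_of_mem (Finset.mem_univ _), Finset.card_univ, edgeFinset_card] at h1
  have h2 : 0 < Fintype.card (CatVertex q t) := Fintype.card_pos_iff.2 ⟨.inl 0⟩
  rw [Nat.card_eq_fintype_card, Nat.card_eq_fintype_card]
  omega

/-- The defining path of a caterpillar, as a diametral path. -/
def catSpine (q : ℕ) (t : ℕ → ℕ) : Spine (catTree q t) (q + 1) where
  v i := .inl ⟨min i (q + 1), by omega⟩
  pos := pos
  ht := ht
  pos_v i hi := by simpa [pos] using hi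
  ht_v i _ := rfl
  v_pos x hx := by
    refine eq_of_ht_eq_zero rfl hx ?_
    have := pos_le x
    change min (pos x) (q + 1) = pos x
    omega
  ht_le x := by rcases x with i | p <;> simp [ht, pos]
  ht_add_le := pos_le
  dist_of_ne x y h := catTree_dist fun hxy => h (congrArg pos hxy)
  dist_le x y h := by
    by_cases hxy : x = y
    · simp [hxy]
    · rw [catTree_dist hxy, h]
      simp [gap]
  le_dist x y h := by
    by_cases hxy : x = y
    · simp [hxy]
    · rw [catTree_dist hxy]
      omega
  even_dist x y h := by
    by_cases hxy : x = y
    · simp [hxy]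
    · rw [catTree_dist hxy, h]
      exact ⟨ht x + ht y, by simp only [gap]; omega⟩
  eq_of_dist x x' y hx hx' hxx h h' := by
    by_cases hxy : x = y <;> by_cases hxy' : x' = y
    · rw [hxy, hxy']
    · rw [catTree_dist hxy'] at h'
      exact eq_of_ht_eq_zero (by omega) (by omega) (by omega)
    · rw [catTree_dist hxy] at h
      exact eq_of_ht_eq_zero (by omega) (by omega) (by omega)
    · rw [catTree_dist hxy] at h
      exact eq_of_ht_eq_zero (by omega) (by omega) (by omega)

theorem catSpine_good (q : ℕ) (t : ℕ → ℕ) : (catSpine q t).Good := by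
  rintro (i | p) hx
  · exact absurd rfl hx
  · refine ⟨rfl, ?_⟩
    have := p.1.2
    change 2 * (p.1.val + 1) ≤ q + 1
    omega

theorem card_catSpine_ecc (q : ℕ) (t : ℕ → ℕ) (e : ℕ) :
    Finset.card {x | (catSpine q t).ht x ≠ 0 ∧ (catSpine q t).ecc x = e} =
      ∑ j ∈ Finset.range ((q + 1) / 2), if q + 1 - j = e then t (j + 1) else 0 := by
  rw [Finset.card_filter, Fintype.sum_sum_type, Fintype.sum_sigma, Finset.sum_range]
  have h0 : ∀ i : Fin (q + 2), ¬ ((catSpine q t).ht (.inl i) ≠ 0 ∧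
      (catSpine q t).ecc (.inl i) = e) := fun i h => h.1 rfl
  simp only [h0, if_false, Finset.sum_const_zero, zero_add]
  refine Finset.sum_congr rfl fun j _ => ?_
  have h1 : ∀ k, ((catSpine q t).ht (.inr ⟨j, k⟩) ≠ 0 ∧ (catSpine q t).ecc (.inr ⟨j, k⟩) = e) ↔
      q + 1 - j.val = e := by
    intro k
    have h2 : (catSpine q t).ht (.inr ⟨j, k⟩) ≠ 0 := one_ne_zero
    have h3 := (catSpine_good q t).ecc_add_pos h2
    have h4 : (catSpine q t).pos (.inr ⟨j, k⟩) = j.val + 1 := rfl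
    have := j.2
    simp only [h2, ne_eq, not_false_eq_true, true_and]
    omega
  simp only [h1]
  split_ifs <;> simp

theorem dist_iso {V V' : Type*} {T : SimpleGraph V} {T' : SimpleGraph V'} (hT : T.Connected)
    (hT' : T'.Connected) (φ : T ≃g T') (x y : V) : T'.dist (φ x) (φ y) = T.dist x y := by
  obtain ⟨p, hp⟩ := hT.exists_walk_length_eq_dist x y
  obtain ⟨r, hr⟩ := hT'.exists_walk_length_eq_dist (φ x) (φ y)
  have h1 := dist_le (p.map φ.toHom)
  have h2 := dist_le ((r.map φ.symm.toHom).copy (φ.symm_apply_apply x) (φ.symm_apply_apply y))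
  rw [Walk.length_map] at h1
  rw [Walk.length_copy, Walk.length_map] at h2
  exact le_antisymm (h1.trans hp.le) (h2.trans hr.le)

theorem totalDist_iso {V V' : Type*} [Fintype V] [Fintype V'] {T : SimpleGraph V}
    {T' : SimpleGraph V'} (hT : T.Connected) (hT' : T'.Connected) (φ : T ≃g T') :
    totalDist T' = totalDist T := by
  rw [Spine.totalDist_image φ.toEquiv]
  exact Finset.sum_congr rfl fun x _ => Finset.sum_congr rfl fun y _ => dist_iso hT hT' φ x y

/-! ### Eccentric sequences through multiplicities. -/

theorem count_powerSeq (l : ℕ) (b m : ℕ → ℕ) (e : ℕ) :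
    (powerSeq l b m).count e = ∑ j ∈ Finset.Icc 1 l, if b j = e then m j else 0 := by
  have h : (Finset.Icc 1 l) = (List.range' 1 l).toFinset := by
    ext j
    simp only [Finset.mem_Icc, List.mem_toFinset, List.mem_range'_1]
    omega
  rw [h, List.sum_toFinset _ List.nodup_range', powerSeq, List.count_flatMap]
  congr 1
  refine List.map_congr_left fun j _ => ?_
  simp [List.count_replicate]

theorem length_powerSeq (l : ℕ) (b m : ℕ → ℕ) :
    (powerSeq l b m).length = ∑ j ∈ Finset.Icc 1 l, m j := by
  have h : (Finset.Icc 1 l) = (List.range' 1 l).toFinset := by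
    ext j
    simp only [Finset.mem_Icc, List.mem_toFinset, List.mem_range'_1]
    omega
  rw [h, List.sum_toFinset _ List.nodup_range', powerSeq, List.length_flatMap]
  simp

theorem length_eccSeq {V : Type*} [Fintype V] (G : SimpleGraph V) :
    (eccSeq G).length = Fintype.card V := by
  simp [eccSeq]

namespace Spine

variable {V V' : Type*} [Fintype V] [Fintype V'] {T : SimpleGraph V} {T' : SimpleGraph V'} {D : ℕ}

theorem count_eccSeq (hT : T.Connected) (σ : Spine T D) (e : ℕ) :
    (eccSeq T).count e = Finset.card {x | σ.ecc x = e} := by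
  rw [← Multiset.coe_count, eccSeq, Multiset.sort_eq, Multiset.count_map, Finset.card_def,
    Finset.filter_val]
  simp only [σ.eccent_eq hT, eq_comm]

theorem eccSeq_eq (hT : T.Connected) (hT' : T'.Connected) (σ : Spine T D) (σ' : Spine T' D)
    (h : ∀ e, Finset.card {x | σ.ecc x = e} = Finset.card {x | σ'.ecc x = e}) :
    eccSeq T = eccSeq T' := by
  have : (eccSeq T : Multiset ℕ) = eccSeq T' := by
    ext e
    rw [Multiset.coe_count, Multiset.coe_count, σ.count_eccSeq hT, σ'.count_eccSeq hT', h]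
  rw [eccSeq, eccSeq, Multiset.sort_eq, Multiset.sort_eq] at this
  rw [eccSeq, eccSeq, this]

omit [Fintype V] in
theorem le_ecc (σ : Spine T D) (x : V) :
    (D + 1) / 2 + σ.ht x ≤ σ.ecc x ∧ σ.ecc x ≤ D := by
  have := σ.ht_le x
  have := σ.ht_add_le x
  simp only [ecc]
  omega

theorem exists_ecc_eq_iff (σ : Spine T D) (e : ℕ) :
    0 < Finset.card {x | σ.ecc x = e} ↔ (D + 1) / 2 ≤ e ∧ e ≤ D := by
  rw [Finset.card_pos]
  constructor
  · rintro ⟨x, hx⟩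
    have hx : σ.ecc x = e := by simpa using hx
    have := σ.le_ecc x
    omega
  · intro h
    refine ⟨σ.v e, ?_⟩
    rw [Finset.mem_filter, σ.ecc_v h.2]
    exact ⟨Finset.mem_univ _, by omega⟩

theorem card_path_ecc {e : ℕ} (h : (D + 1) / 2 < e) (he : e ≤ D) :
    Finset.card ((Finset.range (D + 1)).filter fun i => max i (D - i) = e) = 2 := by
  rw [Finset.card_eq_two]
  refine ⟨e, D - e, by omega, ?_⟩
  ext i
  simp only [Finset.mem_filter, Finset.mem_range, Finset.mem_insert, Finset.mem_singleton]
  omega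

theorem card_le_two (σ : Spine T D) (hD : D ≤ 1) : Fintype.card V ≤ 2 := by
  have h : ∀ x, σ.ht x = 0 := fun x => by
    have := σ.ht_le x
    have := σ.ht_add_le x
    omega
  have h2 := σ.sum_path (fun _ => 1)
  simp only [h, Finset.filter_true, Finset.sum_const, Finset.card_univ, Finset.card_range,
    smul_eq_mul, mul_one] at h2
  omega

variable {l : ℕ} {b m : ℕ → ℕ}

theorem card_ecc_eq_of_eccSeq (hT : T.Connected) (σ : Spine T D)
    (hS : eccSeq T = powerSeq l b m) (hb : StrictMonoOn b (Set.Icc 1 l)) {j : ℕ}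
    (hj : j ∈ Set.Icc 1 l) : Finset.card {x | σ.ecc x = b j} = m j := by
  rw [← σ.count_eccSeq hT, hS, count_powerSeq, Finset.sum_eq_single j]
  · simp
  · intro k hk hkj
    rw [if_neg]
    exact fun h => hkj (hb.injOn (by simpa using hk) hj h)
  · intro h
    exact absurd (by simpa using hj) h

/-- The path alone attains every value from ⌈D/2⌉ to D and nothing else occurs. A strictly
increasing list of an interval is forced; climbing from the bottom and descending from the top pin
down each entry. -/
theorem b_eq_of_eccSeq (hT : T.Connected) (σ : Spine T D)
    (hS : eccSeq T = powerSeq l b m) (hb : StrictMonoOn b (Set.Icc 1 l))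
    (hm : ∀ j ∈ Set.Icc 1 l, 0 < m j) :
    l = D / 2 + 1 ∧ ∀ j ∈ Set.Icc 1 l, b j + l = D + j := by
  have himg : (Finset.Icc 1 l).image b = Finset.Icc ((D + 1) / 2) D := by
    ext e
    rw [Finset.mem_Icc, ← σ.exists_ecc_eq_iff, Finset.mem_image]
    constructor
    · rintro ⟨j, hj, rfl⟩
      have hj : j ∈ Set.Icc 1 l := by simpa using hj
      rw [σ.card_ecc_eq_of_eccSeq hT hS hb hj]
      exact hm j hj
    · intro h
      by_contra hne
      rw [← σ.count_eccSeq hT, hS, count_powerSeq, Finset.sum_eq_zero] at h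
      · exact lt_irrefl _ h
      · intro j hj
        rw [if_neg]
        exact fun hbj => hne ⟨j, hj, hbj⟩
  have hl : l = D / 2 + 1 := by
    have h := congrArg Finset.card himg
    rw [Finset.card_image_of_injOn (by simpa using hb.injOn), Nat.card_Icc, Nat.card_Icc] at h
    omega
  have hmem : ∀ j ∈ Set.Icc 1 l, (D + 1) / 2 ≤ b j ∧ b j ≤ D := by
    intro j hj
    rw [← Finset.mem_Icc, ← himg]
    exact Finset.mem_image_of_mem _ (by simpa using hj)
  have hup : ∀ j, 1 ≤ j → j ≤ l → (D + 1) / 2 + j ≤ b j + 1 := by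
    intro j hj
    induction j, hj using Nat.le_induction with
    | base => intro h; have := hmem 1 ⟨le_rfl, h⟩; omega
    | succ j hj ih =>
      intro h
      have := ih (by omega)
      have := hb ⟨hj, by omega⟩ ⟨by omega, h⟩ (Nat.lt_succ_self j)
      omega
  have hdown : ∀ k, k < l → b (l - k) + k ≤ D := by
    intro k
    induction k with
    | zero => intro h; have := hmem l ⟨h, le_rfl⟩; simpa using this.2
    | succ k ih =>
      intro h
      have := ih (by omega)
      have := hb (a := l - (k + 1)) (b := l - k) ⟨by omega, by omega⟩ ⟨by omega, by omega⟩
        (by omega)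
      omega
  refine ⟨hl, fun j hj => ?_⟩
  have h1 := hup j hj.1 hj.2
  have h2 := hdown (l - j) (by have := hj.1; have := hj.2; omega)
  have := hj.2
  rw [Nat.sub_sub_self this] at h2
  omega

/-- Every value above ⌈D/2⌉ is taken by exactly two path vertices, which accounts for the 2
subtracted in the definition of the extremal tree. -/
theorem two_le_of_eccSeq (hT : T.Connected) (σ : Spine T D)
    (hS : eccSeq T = powerSeq l b m) (hb : StrictMonoOn b (Set.Icc 1 l))
    (hm : ∀ j ∈ Set.Icc 1 l, 0 < m j) {j : ℕ} (hj : j ∈ Set.Icc 2 l) :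
    m j = 2 + Finset.card {x | σ.ht x ≠ 0 ∧ σ.ecc x = b j} := by
  have hj' : j ∈ Set.Icc 1 l := ⟨by have := hj.1; omega, hj.2⟩
  obtain ⟨h1, h2⟩ := σ.b_eq_of_eccSeq hT hS hb hm
  have h3 := h2 j hj'
  have := hj.1
  have := hj.2
  rw [← σ.card_ecc_eq_of_eccSeq hT hS hb hj', card_ecc_eq, card_path_ecc] <;> omega

theorem card_ecc_eq_catSpine {q : ℕ} (hT : T.Connected) (σ : Spine T (q + 1))
    (hS : eccSeq T = powerSeq l b m) (hb : StrictMonoOn b (Set.Icc 1 l))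
    (hm : ∀ j ∈ Set.Icc 1 l, 0 < m j) (e : ℕ) :
    Finset.card {x | σ.ecc x = e} =
      Finset.card {x | (catSpine q fun j => m (l + 1 - j) - 2).ecc x = e} := by
  obtain ⟨hl, hbj⟩ := σ.b_eq_of_eccSeq hT hS hb hm
  rw [card_ecc_eq, card_ecc_eq, card_catSpine_ecc]
  congr 1
  by_cases he : (q + 1 + 1) / 2 < e ∧ e ≤ q + 1
  -- The pendant vertices at v_{j+1} have eccentricity q + 1 - j, so only j = q + 1 - e contributes.
  -- Outside the range of this case no off-path vertex exists, as a positive height lifts the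
  -- eccentricity above ⌈D/2⌉.
  · rw [Finset.sum_eq_single (q + 1 - e)]
    · rw [if_pos (by omega)]
      have hj : l + 1 - (q + 1 - e + 1) ∈ Set.Icc 2 l := ⟨by omega, by omega⟩
      have h1 := hbj _ ⟨by have := hj.1; omega, hj.2⟩
      have h2 := σ.two_le_of_eccSeq hT hS hb hm hj
      rw [show b (l + 1 - (q + 1 - e + 1)) = e by omega] at h2
      omega
    · intro j hj hje
      rw [Finset.mem_range] at hj
      rw [if_neg (by omega)]
    · intro h
      rw [Finset.mem_range] at h
      omega
  · rw [Finset.sum_eq_zero, Finset.card_eq_zero, Finset.filter_eq_empty_iff]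
    · rintro x - ⟨h1, h2⟩
      have := σ.le_ecc x
      omega
    · intro j hj
      rw [Finset.mem_range] at hj
      rw [if_neg (by omega)]

/-- A tree with more than two vertices has diameter at least 2, and the diameter is b_l. The length
is written `b l - 1 + 1` to match `catSpine` with q = b_l - 1. -/
theorem two_le_and_nonempty (hT : T.IsTree) (hS : eccSeq T = powerSeq l b m)
    (hb : StrictMonoOn b (Set.Icc 1 l)) (hm : ∀ j ∈ Set.Icc 1 l, 0 < m j)
    (hn : 2 < ∑ j ∈ Finset.Icc 1 l, m j) : 2 ≤ b l ∧ Nonempty (Spine T (b l - 1 + 1)) := by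
  obtain ⟨σ⟩ := nonempty_of_isTree hT
  obtain ⟨hl, hbj⟩ := σ.b_eq_of_eccSeq hT.connected hS hb hm
  have hbl := hbj l ⟨by omega, le_rfl⟩
  have hcard : 2 < Fintype.card V := by
    rwa [← length_eccSeq T, hS, length_powerSeq]
  have hD : 2 ≤ T.diam := by
    by_contra h
    have := σ.card_le_two (by omega)
    omega
  rw [show b l - 1 + 1 = T.diam by omega]
  exact ⟨by omega, ⟨σ⟩⟩

end Spine

end EccTree

/-! ### The extremal tree for all five indices. -/

theorem mainTheorem3 (l : ℕ) (b m : ℕ → ℕ)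
    (hb : StrictMonoOn b (Set.Icc 1 l)) (hm : ∀ j ∈ Set.Icc 1 l, 0 < m j)
    (hS : EccTree.IsTreeEccentric (EccTree.powerSeq l b m))
    (hn : 2 < ∑ j ∈ Finset.Icc 1 l, m j) :
    -- the notation `𝕋(m_l - 2, …, m₂ - 2)` makes sense
    (2 ≤ b l ∧ (b l - 1 + 1) / 2 = l - 1 ∧ ∀ j ∈ Set.Icc 2 l, 2 ≤ m j) ∧
    (EccTree.catTree (b l - 1) fun j => m (l + 1 - j) - 2).IsTree ∧
    EccTree.eccSeq (EccTree.catTree (b l - 1) fun j => m (l + 1 - j) - 2) =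
      EccTree.powerSeq l b m ∧
    ∀ (I : EccTree.WienerVariant) (V : Type*) [Fintype V] (T : SimpleGraph V),
      T.IsTree → EccTree.eccSeq T = EccTree.powerSeq l b m →
        I.index (EccTree.catTree (b l - 1) fun j => m (l + 1 - j) - 2) ≤ I.index T ∧
        (I.index T = I.index (EccTree.catTree (b l - 1) fun j => m (l + 1 - j) - 2) ↔
          Nonempty (T ≃g EccTree.catTree (b l - 1) fun j => m (l + 1 - j) - 2)) := by
  obtain ⟨V₀, _, T₀, hT₀, hS₀⟩ := hS
  obtain ⟨hbl, ⟨σ₀⟩⟩ := EccTree.Spine.two_le_and_nonempty hT₀ hS₀ hb hm hn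
  obtain ⟨hl, -⟩ := σ₀.b_eq_of_eccSeq hT₀.connected hS₀ hb hm
  have hC := EccTree.catTree_isTree (b l - 1) fun j => m (l + 1 - j) - 2
  have hCS : EccTree.eccSeq (EccTree.catTree (b l - 1) fun j => m (l + 1 - j) - 2) =
      EccTree.powerSeq l b m :=
    (EccTree.Spine.eccSeq_eq hT₀.connected hC.connected σ₀ (EccTree.catSpine _ _)
      (σ₀.card_ecc_eq_catSpine hT₀.connected hS₀ hb hm)).symm.trans hS₀
  refine ⟨⟨hbl, by omega, fun j hj => ?_⟩, hC, hCS, fun I V _ T hT hTS => ?_⟩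
  · rw [σ₀.two_le_of_eccSeq hT₀.connected hS₀ hb hm hj]
    omega
  · obtain ⟨-, ⟨σ⟩⟩ := EccTree.Spine.two_le_and_nonempty hT hTS hb hm hn
    obtain ⟨hle, hiso⟩ := EccTree.Spine.totalDist_le_and_iso hT.connected hC.connected σ
      (EccTree.catSpine_good _ _) (σ.card_ecc_eq_catSpine hT.connected hTS hb hm)
    -- Equal sequences have equal lengths, so both trees have the same order and the offsets of the
    -- index cancel.
    have hcard : Fintype.card (EccTree.CatVertex (b l - 1) fun j => m (l + 1 - j) - 2) =
        Fintype.card V := by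
      rw [← EccTree.length_eccSeq T, hTS, ← hCS, EccTree.length_eccSeq]
    rw [I.index_eq hT, I.index_eq hC, hcard]
    have hpos := I.coeff_pos
    refine ⟨?_, ?_, ?_⟩
    · have : (EccTree.totalDist (EccTree.catTree (b l - 1) fun j => m (l + 1 - j) - 2) : ℚ) ≤
          EccTree.totalDist T := Nat.cast_le.2 hle
      nlinarith
    · intro h
      exact hiso (Nat.cast_injective (R := ℚ) (mul_left_cancel₀ hpos.ne' (add_right_cancel h)))
    · rintro ⟨φ⟩
      rw [EccTree.totalDist_iso hT.connected hC.connected φ]
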